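/- Let $K$ be a field of characteristic zero with algebraic closure $\overline K$, and let $\sigma$ be the automorphism $f(x)\mapsto f(x+1)$ of $K(x)$. Rational functions are written in lowest terms with monic denominator, $\gcd$ and $\operatorname{lcm}$ are monic, $\deg 0<0$, and $f$ is *proper* if $\deg(\mathrm{numer} f)<\deg(\mathrm{denom} f)$. A nonzero polynomial $b$ is *squarefree* if $\gcd(b,b')=1$, and *shiftfree* if $\gcd(b,\sigma^\ell b)=1$ for all integers $\ell\ge 1$. For $\alpha\in\overline K$ put $\omega(\alpha)=\alpha+\mathbb Z\in\overline K/\mathbb Z$. *Discrete residues.* For $f\in K(x)$ with complete partial fraction decomposition $f=p+\sum_{k\ge1}\sum_{\alpha\in\overline K}\frac{c_k(\alpha)}{(x-\alpha)^k}$, $p\in K[x]$, set $\mathrm{dres}(f,\omega,k)=\sum_{\alpha\in\omega}c_k(\alpha)$ for $\omega\in\overline K/\mathbb Z$, $k\geq 1$. A *$K$-rational system of discrete residues* of $f$ is a sequence of pairs $(B_1,D_1),\dots,(B_m,D_m)$ in $K[x]^2$ such that $f$ has no pole of order higher than $m$ and, for each $1\le k\le m$: $B_k$ is nonzero, squarefree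 and shiftfree, and $\deg D_k<\deg B_k$; $\mathrm{dres}(f,\omega,k)=0$ for every orbit $\omega$ that contains no root of $B_k$; and $\mathrm{dres}(f,\omega(\alpha),k)=D_k(\alpha)$ for every root $\alpha\in\overline K$ of $B_k$. *The procedures.* - $\mathtt{HermiteReduction}(f)=(g,h)$, for proper $f$: the unique proper $g,h\in K(x)$ such that $f=\frac{d}{dx}g+h$ and $h$ has squarefree denominator. - $\mathtt{HermiteList}(f)$, for proper $f\ne0$: start with $g\leftarrow f$, $m\leftarrow0$; while $g\neq0$, set $(g,\hat f_{m+1})\leftarrow\mathtt{HermiteReduction}(g)$ and $m\leftarrow m+1$; return $(f_1,\dots,f_m)$ with $f_k=(-1)^{k-1}(k-1)!\,\hat f_k$. - $\mathtt{ShiftSet}(b)$, for squarefree $b\ne0$: if $\deg b\le1$ return $\emptyset$; otherwise let $R(z)=\mathrm{Res}_x(b(x),b(x+z))$, $\tilde R=R/(z\gcd(R,\frac{dR}{dz}))$ (exact division), let $T$ be the polynomial with $T(z^2)=\tilde R(z)$, and return $\{\ell\in\mathbb Z_{\ge1}: T(\ell^2)=0\}$. - $\mathtt{ParFrac}(f;b_\ell\mid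 \ell\in N)$, for proper $f$ with squarefree denominator $\prod_{\ell\in N} b_\ell$, the $b_\ell$ monic and nonconstant: the unique nonzero polynomials $(a_\ell\mid\ell\in N)$ with $\deg a_\ell<\deg b_\ell$ and $f=\sum_\ell a_\ell/b_\ell$. - $\mathtt{SimpleReduction}^+(f_1,\dots,f_N)$, for proper $f_j$ with squarefree denominators $b_j$: let $b=\operatorname{lcm}(b_1,\dots,b_N)$ and $S=\mathtt{ShiftSet}(b)$. If $S=\emptyset$, return $(f_1,\dots,f_N)$. Otherwise let $G=\operatorname{lcm}(\gcd(b,\sigma^{-\ell}b)\mid\ell\in S)$ and $b_0=b/G$ (exact division); for each $j$ let $b_{j,\ell}=\gcd(\sigma^{-\ell}b_0,b_j)$ for $\ell\in S\cup\{0\}$, $N_j=\{\ell\in S\cup\{0\}:\deg b_{j,\ell}\ge1\}$, $(a_{j,\ell}\mid \ell\in N_j)=\mathtt{ParFrac}(f_j;b_{j,\ell}\mid\ell\in N_j)$ and $\bar f_j=\sum_{\ell\in N_j}\sigma^\ell(a_{j,\ell}/b_{j,\ell})$; return $(\bar f_1,\dots,\bar f_N)$. - $\mathtt{FirstResidues}(f)=(b,r)$,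 for proper $f=a/b\neq 0$ with squarefree denominator $b$: $r$ is the unique nonzero polynomial with $\deg r<\deg b$ and $r\,b'\equiv a\pmod b$; and $\mathtt{FirstResidues}(0)=(1,0)$. - $\mathtt{FirstResidues}^+(f_1,\dots,f_N)=(b;(p_1,\dots,p_N))$, for proper $f_j$ with squarefree denominators: with $\mathtt{FirstResidues}(f_j)=(b_j,r_j)$, let $b=\operatorname{lcm}(b_1,\dots,b_N)$; $p_j$ is the unique polynomial with $\deg p_j<\deg b$, $p_j\,b_j'\equiv\mathrm{numer}(f_j)\pmod{b_j}$ and $p_j\equiv0\pmod{b/b_j}$. - $\mathtt{DiscreteResidues}^+(f_1,\dots,f_n)$, for proper nonzero $f_i$: compute $(f_{i,1},\dots,f_{i,m_i})=\mathtt{HermiteList}(f_i)$ for each $i$, let $m=\max_i m_i$, put $f_{i,k}=0$ for $m_i<k\le m$, and return $(B;(D_{i,k})_{1\le i\le n,\,1\le k\le m})=\mathtt{FirstResidues}^+\bigl(\mathtt{SimpleReduction}^+(f_{i,k}\mid 1\le i\le n,\ 1\le k\le m)\bigr)$. **Claim.** $\mathtt{DiscreteResidues}^+$ is correct: for every $n$-tuple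 $(f_1,\dots,f_n)$ of proper nonzero elements of $K(x)$, every step of the procedure can be carried out (all called procedures receive admissible inputs, all divisions are exact, all loops are finite), and it returns a uniquely determined output $(B;(D_{i,k})_{1\le i\le n,1\le k\le m})$ in $K[x]$. Moreover, $B$ is squarefree and shiftfree, and for each $1\le i\le n$ the sequence $(B,D_{i,1}),\dots,(B,D_{i,m})$ is a $K$-rational system of discrete residues of $f_i$. In particular any two roots of $B$ in $\overline K$ that lie in the same orbit are equal, so that the same orbit representatives serve all $f_i$ and all orders $k$. -/

import Mathlib

open Polynomial

noncomputable section

namespace DiscreteResidues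

/-! ### Rational functions, base change, orbits -/

section Theory

variable {K : Type*} [Field K]

/-- A rational function is proper if its numerator has smaller degree than its denominator
(zero, written `0 / 1`, is proper). -/
def IsProper (f : RatFunc K) : Prop :=
  f.num.degree < f.denom.degree

/-- The derivation `d/dx` on `K(x)`, by the quotient rule. -/
def deriv (f : RatFunc K) : RatFunc K :=
  algebraMap K[X] (RatFunc K) (derivative f.num * f.denom - f.num * derivative f.denom) /
    algebraMap K[X] (RatFunc K) (f.denom ^ 2)

/-- The automorphism `f(x) ↦ f(x + r)` of `K(x)`; the power `σ ^ ℓ` of the shift is `r = ℓ`. On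
polynomials the same substitution is `Polynomial.taylor r`. -/
def shift (r : K) (f : RatFunc K) : RatFunc K :=
  RatFunc.laurent r f

/-- A polynomial is shiftfree if it is coprime to all its shifts by positive integers. -/
def IsShiftfree (b : K[X]) : Prop :=
  ∀ l : ℕ, 0 < l → IsCoprime b (taylor (l : K) b)

variable (L : Type*) [Field L] [Algebra K L]

/-- The inclusion `K(x) → L(x)`. -/
def baseChange : RatFunc K →+* RatFunc L :=
  RatFunc.mapRingHom (Polynomial.mapRingHom (algebraMap K L))
    (nonZeroDivisors_le_comap_nonZeroDivisors_of_injective _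
      (Polynomial.map_injective _ (algebraMap K L).injective))

/-- The set `L / ℤ` of orbits of the translation action of `ℤ` on `L`. -/
abbrev Orbit : Type _ := L ⧸ (Int.castAddHom L).range

variable {L} in
/-- The orbit `ω(α) = α + ℤ`. -/
def orbit (α : L) : Orbit L := QuotientAddGroup.mk α

/-- The order of the pole of `f` at `α ∈ L` (zero if `f` has no pole there). -/
def poleOrder (f : RatFunc K) (α : L) : ℕ :=
  (f.denom.map (algebraMap K L)).rootMultiplicity α

/-- `f = p + ∑ₖ ∑_α c_k(α) / (x - α) ^ k` with `p ∈ K[x]`, almost all `c_k(α) ∈ L` being zero. -/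
def IsPartialFractionDecomposition (f : RatFunc K) (p : K[X]) (c : ℕ+ × L →₀ L) : Prop :=
  baseChange L f = algebraMap L[X] (RatFunc L) (p.map (algebraMap K L)) +
    c.sum fun i a => RatFunc.C a / (RatFunc.X - RatFunc.C i.2) ^ (i.1 : ℕ)

theorem exists_proper_decomposition [IsAlgClosed L] (r q : L[X]) (hq : q.Monic)
    (hr : r.degree < q.degree) :
    ∃ c : ℕ+ × L →₀ L, algebraMap L[X] (RatFunc L) r / algebraMap L[X] (RatFunc L) q =
      c.sum fun i a => RatFunc.C a / (RatFunc.X - RatFunc.C i.2) ^ (i.1 : ℕ) := by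
  classical
  set s := q.roots.toFinset
  set n : L → ℕ := fun α => q.rootMultiplicity α
  have hprod : ∏ α ∈ s, (X - C α) ^ n α = q := by
    have h := (IsAlgClosed.splits q).eq_prod_roots_of_monic hq
    rw [Finset.prod_multiset_map_count] at h
    simpa [s, n] using h.symm
  have hmon : ∀ α ∈ s, (X - C α : L[X]).Monic := fun α _ => monic_X_sub_C α
  obtain ⟨Q, t, ht, hrt⟩ := eq_quo_mul_prod_pow_add_sum_rem_mul_prod_pow r hmon
    (fun α _ β _ h => isCoprime_X_sub_C_of_isUnit_sub (sub_ne_zero.2 h).isUnit) n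
  rw [hprod] at hrt
  have hdeg : (∑ α ∈ s, ∑ j, t α j * (X - C α) ^ j.1 *
      ∏ β ∈ s.erase α, (X - C β) ^ n β).degree < q.degree := by
    rw [degree_eq_natDegree hq.ne_zero, ← mem_degreeLT]
    refine Submodule.sum_mem _ fun α hα => Submodule.sum_mem _ fun j _ => ?_
    rw [mem_degreeLT, ← degree_eq_natDegree hq.ne_zero]
    have hM : (∏ β ∈ s.erase α, (X - C β) ^ n β).Monic :=
      monic_prod_of_monic _ _ fun β _ => (monic_X_sub_C β).pow _
    rw [← hprod, ← Finset.mul_prod_erase s _ hα, hM.degree_mul, hM.degree_mul]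
    refine WithBot.add_lt_add_right (degree_ne_bot.2 hM.ne_zero) ?_
    have h1 : (t α j).degree ≤ 0 := by
      have := ht α hα j
      rw [degree_X_sub_C] at this
      exact Nat.WithBot.lt_one_iff_le_zero.1 this
    calc (t α j * (X - C α) ^ j.1).degree ≤ 0 + ((X - C α) ^ j.1).degree :=
          (degree_mul_le _ _).trans (add_le_add_left h1 _)
      _ = (j.1 : WithBot ℕ) := by rw [zero_add, degree_pow, degree_X_sub_C, nsmul_one]
      _ < _ := by rw [degree_pow, degree_X_sub_C, nsmul_one]; exact_mod_cast j.2
  have hQ : Q = 0 := by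
    have h := div_modByMonic_unique Q _ hq ⟨(by rw [hrt]; ring : _ + q * Q = r), hdeg⟩
    rw [← h.1, (divByMonic_eq_zero_iff hq).2 hr]
  have hX : ∀ α : L, algebraMap L[X] (RatFunc L) (X - C α) = RatFunc.X - RatFunc.C α := by
    intro α; simp
  have hX0 : ∀ α : L, (RatFunc.X - RatFunc.C α : RatFunc L) ≠ 0 := fun α => by
    rw [← hX]; exact RatFunc.algebraMap_ne_zero (X_sub_C_ne_zero α)
  let v : ℕ+ × L → RatFunc L := fun i => ((RatFunc.X - RatFunc.C i.2) ^ (i.1 : ℕ))⁻¹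
  have hmem : algebraMap L[X] (RatFunc L) r / algebraMap L[X] (RatFunc L) q ∈
      Submodule.span L (Set.range v) := by
    rw [hrt, hQ, zero_mul, zero_add, map_sum, Finset.sum_div]
    refine Submodule.sum_mem _ fun α hα => ?_
    rw [map_sum, Finset.sum_div]
    refine Submodule.sum_mem _ fun j _ => ?_
    have h0 : (t α j).degree ≤ 0 := by
      have := ht α hα j
      rw [degree_X_sub_C] at this
      exact Nat.WithBot.lt_one_iff_le_zero.1 this
    have key : algebraMap L[X] (RatFunc L) (t α j * (X - C α) ^ j.1 *
        ∏ β ∈ s.erase α, (X - C β) ^ n β) / algebraMap L[X] (RatFunc L) q =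
        (t α j).coeff 0 • v (⟨n α - j.1, Nat.sub_pos_of_lt j.2⟩, α) := by
      rw [RatFunc.smul_eq_C_mul]
      have hM : algebraMap L[X] (RatFunc L) (∏ β ∈ s.erase α, (X - C β) ^ n β) ≠ 0 :=
        RatFunc.algebraMap_ne_zero
          (monic_prod_of_monic _ _ fun β _ => (monic_X_sub_C β).pow _).ne_zero
      rw [← hprod, ← Finset.mul_prod_erase s _ hα, map_mul, map_mul _ (_ ^ n α),
        mul_div_mul_right _ _ hM, eq_C_of_degree_le_zero h0]
      simp only [map_mul, map_pow, hX, v, PNat.mk_coe, RatFunc.algebraMap_C, coeff_C_zero]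
      rw [mul_div_assoc, pow_sub₀ _ (hX0 α) j.2.le, mul_inv, inv_inv]
      ring
    rw [key]
    exact Submodule.smul_mem _ _ (Submodule.subset_span ⟨_, rfl⟩)
  obtain ⟨c, hc⟩ := Finsupp.mem_span_range_iff_exists_finsupp.1 hmem
  refine ⟨c, hc.symm.trans (Finset.sum_congr rfl fun i _ => ?_)⟩
  simp only [v, RatFunc.smul_eq_C_mul, div_eq_mul_inv]

theorem exists_isPartialFractionDecomposition [IsAlgClosed L] (f : RatFunc K) :
    ∃ (c : ℕ+ × L →₀ L) (p : K[X]), IsPartialFractionDecomposition L f p c := by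
  have hm := f.monic_denom
  obtain ⟨c, hc⟩ := exists_proper_decomposition L ((f.num %ₘ f.denom).map (algebraMap K L))
    (f.denom.map (algebraMap K L)) (hm.map _) (by
      rw [degree_map, degree_map]; exact degree_modByMonic_lt _ hm)
  refine ⟨c, f.num /ₘ f.denom, ?_⟩
  have h0 : algebraMap L[X] (RatFunc L) (f.denom.map (algebraMap K L)) ≠ 0 :=
    RatFunc.algebraMap_ne_zero (hm.map _).ne_zero
  have hf : baseChange L f = algebraMap L[X] (RatFunc L) (f.num.map (algebraMap K L)) /
      algebraMap L[X] (RatFunc L) (f.denom.map (algebraMap K L)) := by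
    conv_lhs => rw [← f.num_div_denom]
    exact RatFunc.map_apply_div (Polynomial.mapRingHom (algebraMap K L))
      (nonZeroDivisors_le_comap_nonZeroDivisors_of_injective _
        (Polynomial.map_injective _ (algebraMap K L).injective)) f.num f.denom
  rw [IsPartialFractionDecomposition, ← hc, hf, eq_comm, eq_div_iff h0, add_mul,
    div_mul_cancel₀ _ h0, ← map_mul, ← map_add, ← Polynomial.map_mul, ← Polynomial.map_add]
  congr 2
  rw [add_comm, mul_comm]
  exact modByMonic_add_div _ _

/-- The coefficients `c_k(α)` of the complete partial fraction decomposition of `f`. -/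
def coeffs [IsAlgClosed L] (f : RatFunc K) : ℕ+ × L →₀ L :=
  (exists_isPartialFractionDecomposition L f).choose

variable {L} in
/-- The discrete residue `dres(f, ω, k) = ∑_{α ∈ ω} c_k(α)`. -/
def dres [IsAlgClosed L] (f : RatFunc K) (ω : Orbit L) (k : ℕ+) : L :=
  ∑ᶠ (α : L) (_ : orbit α = ω), coeffs L f (k, α)

/-- `(B₁, D₁), …, (B_m, D_m)` is a `K`-rational system of discrete residues of `f`. The entry of
index `k : Fin m` is the one of order `k + 1`. -/
structure IsRationalSystem [IsAlgClosed L] (f : RatFunc K) {m : ℕ} (S : Fin m → K[X] × K[X]) :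
    Prop where
  poleOrder_le : ∀ α : L, poleOrder L f α ≤ m
  ne_zero : ∀ k, (S k).1 ≠ 0
  squarefree : ∀ k, Squarefree (S k).1
  shiftfree : ∀ k, IsShiftfree (S k).1
  degree_lt : ∀ k, (S k).2.degree < (S k).1.degree
  dres_eq_zero : ∀ (k : Fin m) (ω : Orbit L),
    (∀ α : L, orbit α = ω → aeval α (S k).1 ≠ 0) → dres f ω (Nat.succPNat k) = 0
  dres_eq : ∀ (k : Fin m) (α : L),
    aeval α (S k).1 = 0 → dres f (orbit α) (Nat.succPNat k) = aeval α (S k).2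

end Theory

/-! ### The procedures

Each procedure is given by its input-output relation: `Proc input output` says that the procedure
accepts `input`, that all its steps can be carried out (the requirements of the called procedures
are met, divisions are exact, sets looped over are finite, loops terminate), and that it returns
`output`. -/

section Procedures

variable {K : Type*} [Field K]

/-- `d` is the monic greatest common divisor of `a` and `b`. -/
structure IsMonicGcd (a b d : K[X]) : Prop where
  monic : d.Monic
  dvd_left : d ∣ a
  dvd_right : d ∣ b
  dvd : ∀ c, c ∣ a → c ∣ b → c ∣ d

/-- `b` is the monic least common multiple of the `a i`, `i ∈ s` (it is `1` if `s` is empty). -/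
structure IsMonicLcm {ι : Type*} (s : Finset ι) (a : ι → K[X]) (b : K[X]) : Prop where
  monic : b.Monic
  dvd : ∀ i ∈ s, a i ∣ b
  dvd_of_dvd : ∀ c, (∀ i ∈ s, a i ∣ c) → b ∣ c

/-- `HermiteReduction(f) = (g, h)`. -/
structure HermiteReduction (f g h : RatFunc K) : Prop where
  proper : IsProper f
  proper_left : IsProper g
  proper_right : IsProper h
  eq : f = deriv g + h
  squarefree : Squarefree h.denom

/-- The loop of `HermiteList`: started with the value `g` of its variable, it terminates after
having produced the given list of functions `f̂`. -/
inductive HermiteLoop : RatFunc K → List (RatFunc K) → Prop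
  | done : HermiteLoop 0 []
  | step {g g' h : RatFunc K} {l : List (RatFunc K)} : g ≠ 0 → HermiteReduction g g' h →
      HermiteLoop g' l → HermiteLoop g (h :: l)

/-- `HermiteList(f) = (f₁, …, f_m)`, where `f_k = (-1) ^ (k - 1) (k - 1)! f̂_k`; list positions
are counted from `0`. -/
def HermiteList (f : RatFunc K) (l : List (RatFunc K)) : Prop :=
  IsProper f ∧ f ≠ 0 ∧ ∃ l' : List (RatFunc K), HermiteLoop f l' ∧
    l = l'.mapIdx fun k h => (-1) ^ k * (k.factorial : RatFunc K) * h

/-- `R(z) = Resultant_x(b(x), b(x + z)) ∈ K[z]`. -/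
def shiftResultant (b : K[X]) : K[X] :=
  resultant (b.map (C : K →+* K[X])) (taylor (X : K[X]) (b.map (C : K →+* K[X])))

/-- `ShiftSet(b) = S`, as computed from the resultant: `R̃ = R / (z · gcd(R, dR/dz))` (exact
division), `T(z ^ 2) = R̃(z)`, and `S` is the set of positive integers `ℓ` with `T(ℓ ^ 2) = 0`. -/
def ShiftSet (b : K[X]) (S : Finset ℕ) : Prop :=
  b ≠ 0 ∧ Squarefree b ∧
    ((b.natDegree ≤ 1 ∧ S = ∅) ∨
      (1 < b.natDegree ∧ ∃ g R' T : K[X],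
        IsMonicGcd (shiftResultant b) (derivative (shiftResultant b)) g ∧
        shiftResultant b = R' * (X * g) ∧
        T.comp (X ^ 2) = R' ∧
        ∀ l : ℕ, l ∈ S ↔ 0 < l ∧ T.eval ((l : K) ^ 2) = 0))

/-- `ParFrac(f; b_ℓ | ℓ ∈ N) = (a_ℓ | ℓ ∈ N)`. -/
structure ParFrac (f : RatFunc K) (N : Finset ℕ) (b a : ℕ → K[X]) : Prop where
  proper : IsProper f
  squarefree : Squarefree f.denom
  monic : ∀ l ∈ N, (b l).Monic
  nonconstant : ∀ l ∈ N, 1 ≤ (b l).natDegree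
  prod_eq : ∏ l ∈ N, b l = f.denom
  ne_zero : ∀ l ∈ N, a l ≠ 0
  degree_lt : ∀ l ∈ N, (a l).degree < (b l).degree
  eq_sum : f = ∑ l ∈ N,
    algebraMap K[X] (RatFunc K) (a l) / algebraMap K[X] (RatFunc K) (b l)

/-- The branch `S ≠ ∅` of `SimpleReduction⁺`, with `b` the least common multiple of the
denominators. Here `bb i ℓ = gcd(σ^{-ℓ}(b₀), b_i)`. -/
def ReduceBranch {ι : Type*} (f : ι → RatFunc K) (b : K[X]) (S : Finset ℕ)
    (f' : ι → RatFunc K) : Prop :=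
  ∃ (g : ℕ → K[X]) (G b₀ : K[X]),
    (∀ l ∈ S, IsMonicGcd b (taylor (-(l : K)) b) (g l)) ∧
    IsMonicLcm S g G ∧
    b = b₀ * G ∧
    ∀ i, ∃ (bb a : ℕ → K[X]) (N : Finset ℕ),
      (∀ l ∈ insert 0 S, IsMonicGcd (taylor (-(l : K)) b₀) (f i).denom (bb l)) ∧
      N = {l ∈ insert 0 S | 1 ≤ (bb l).natDegree} ∧
      ParFrac (f i) N bb a ∧
      f' i = ∑ l ∈ N, shift (l : K)
        (algebraMap K[X] (RatFunc K) (a l) / algebraMap K[X] (RatFunc K) (bb l))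

/-- `SimpleReduction⁺(f) = f'`, for a finite family `f`. -/
def SimpleReductionPlus {ι : Type*} [Fintype ι] (f f' : ι → RatFunc K) : Prop :=
  (∀ i, IsProper (f i) ∧ Squarefree (f i).denom) ∧
    ∃ (b : K[X]) (S : Finset ℕ),
      IsMonicLcm Finset.univ (fun i => (f i).denom) b ∧
      ShiftSet b S ∧
      ((S = ∅ ∧ f' = f) ∨ (S ≠ ∅ ∧ ReduceBranch f b S f'))

/-- `FirstResidues(f) = (b, r)`: for `f ≠ 0` with numerator `a` and squarefree denominator `b`,
`r` is the polynomial of degree less than `deg b` with `r · db/dx ≡ a` modulo `b`, that is, with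
value `a(α) / b'(α)` (the residue of `f`) at each root `α` of `b`. -/
def FirstResidues (f : RatFunc K) (b r : K[X]) : Prop :=
  (f = 0 ∧ b = 1 ∧ r = 0) ∨
    (f ≠ 0 ∧ IsProper f ∧ Squarefree f.denom ∧ b = f.denom ∧ r ≠ 0 ∧
      r.degree < b.degree ∧ b ∣ r * derivative b - f.num)

/-- `FirstResidues⁺(f) = (b; p)`, for a finite family `f`. -/
def FirstResiduesPlus {ι : Type*} [Fintype ι] (f : ι → RatFunc K) (b : K[X]) (p : ι → K[X]) :
    Prop :=
  (∀ i, IsProper (f i) ∧ Squarefree (f i).denom) ∧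
    ∃ b' r : ι → K[X],
      (∀ i, FirstResidues (f i) (b' i) (r i)) ∧
      IsMonicLcm Finset.univ b' b ∧
      ∀ i, ∃ d : K[X], b = d * b' i ∧
        (p i).degree < b.degree ∧
        b' i ∣ p i * derivative (b' i) - (f i).num ∧
        d ∣ p i

/-- An output of `DiscreteResidues⁺`: a polynomial `B` and an array of polynomials `D_{i,k}` with
`n` rows and `m` columns; the column of index `k : Fin m` is the one of order `k + 1`. -/
structure Output (K : Type*) [Field K] (n : ℕ) where
  m : ℕ
  B : K[X]
  D : Fin n → Fin m → K[X]

/-- `DiscreteResidues⁺(f₁, …, f_n) = (B; D)`. The lists `l i = HermiteList(f_i)` are extended by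
`0` to the maximal length `m`. -/
def DiscreteResiduesPlus {n : ℕ} (f : Fin n → RatFunc K) (out : Output K n) : Prop :=
  (∀ i, IsProper (f i) ∧ f i ≠ 0) ∧
    ∃ (l : Fin n → List (RatFunc K)) (f' : Fin n × Fin out.m → RatFunc K),
      (∀ i, HermiteList (f i) (l i)) ∧
      out.m = Finset.univ.sup (fun i => (l i).length) ∧
      SimpleReductionPlus (fun ik : Fin n × Fin out.m => (l ik.1).getD ik.2 0) f' ∧
      FirstResiduesPlus f' out.B (fun ik => out.D ik.1 ik.2)

end Procedures

end DiscreteResidues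

end

namespace DiscreteResidues

/-! ### Greatest common divisors, least common multiples, and the shift set -/

section ShiftSet

variable {K : Type*} [Field K]

/-! Everything is read off the coefficients c_k(α) over `L`. They are unique (`polarSum_unique`),
additive, translated by shifts, and changed by d/dx in a simple way: order k becomes order k + 1
with a factor -k. A proper function is determined by them (`IsProper.eq_of_coeffs_eq`).

Iterated Hermite reduction therefore turns the order-k coefficients of f into the residues at simple
poles of f_k, the factor (-1)^(k-1) (k-1)! being what k - 1 differentiations produce
(`HermiteList.coeffs_eq`). Only residues of functions with squarefree denominators remain to be
treated.

Let b be the common denominator. Call a root of b initial if subtracting a positive integer never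
gives another root. The polynomial b₀ has exactly the initial roots (`isInitialPart_of_isMonicLcm`),
so it is shiftfree, and every root of b is an initial root plus a unique ℓ ∈ S ∪ {0}. Hence each
denominator splits into coprime factors according to ℓ (`prod_eq_of_isInitialPart`), and moving the
ℓ-th summand by σ^ℓ puts its poles among the roots of b₀. Orbit sums do not notice the move
(`dres_shift`).

With a shiftfree denominator each orbit contains at most one pole, so the discrete residue is the
ordinary residue a(α)/b'(α). The Chinese remainder theorem interpolates these values on the common
denominator B, with value zero where a particular function has no pole
(`FirstResiduesPlus.aeval_eq`).

Two steps are not obviously executable. The polynomial T in the shift set exists because the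
resultant is even or odd (`ShiftSet.exists`). Hermite reduction exists by a dimension count, from
its own uniqueness (`HermiteReduction.exists`). -/

theorem exists_monic_associated {p : K[X]} (hp : p ≠ 0) : ∃ q : K[X], q.Monic ∧ Associated p q := by
  classical
  exact ⟨normalize p, monic_normalize hp, associated_normalize p⟩

theorem IsMonicGcd.exists {a b : K[X]} (ha : a ≠ 0) : ∃ d, IsMonicGcd a b d := by
  classical
  have h0 : EuclideanDomain.gcd a b ≠ 0 := fun h => ha (EuclideanDomain.gcd_eq_zero_iff.1 h).1
  obtain ⟨d, hd, hda⟩ := exists_monic_associated h0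
  exact ⟨d, hd, hda.symm.dvd.trans (EuclideanDomain.gcd_dvd_left _ _),
    hda.symm.dvd.trans (EuclideanDomain.gcd_dvd_right _ _),
    fun c h₁ h₂ => (EuclideanDomain.dvd_gcd h₁ h₂).trans hda.dvd⟩

theorem IsMonicGcd.unique {a b d d' : K[X]} (h : IsMonicGcd a b d) (h' : IsMonicGcd a b d') :
    d = d' :=
  eq_of_monic_of_associated h.monic h'.monic
    (associated_of_dvd_dvd (h'.dvd _ h.dvd_left h.dvd_right) (h.dvd _ h'.dvd_left h'.dvd_right))

theorem IsMonicLcm.exists {ι : Type*} (s : Finset ι) {a : ι → K[X]} (ha : ∀ i ∈ s, a i ≠ 0) :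
    ∃ b, IsMonicLcm s a b := by
  classical
  let _ : NormalizedGCDMonoid K[X] := Classical.choice inferInstance
  have h0 : s.lcm a ≠ 0 := by
    rw [Ne, Finset.lcm_eq_zero_iff]
    rintro ⟨i, hi, h⟩
    exact ha i hi h
  obtain ⟨b, hb, hba⟩ := exists_monic_associated h0
  exact ⟨b, hb, fun i hi => (Finset.dvd_lcm hi).trans hba.dvd,
    fun c hc => hba.symm.dvd.trans (Finset.lcm_dvd hc)⟩

theorem IsMonicLcm.unique {ι : Type*} {s : Finset ι} {a a' : ι → K[X]} {b b' : K[X]}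
    (h : IsMonicLcm s a b) (h' : IsMonicLcm s a' b') (haa : ∀ i ∈ s, a i = a' i) : b = b' :=
  eq_of_monic_of_associated h.monic h'.monic
    (associated_of_dvd_dvd (h.dvd_of_dvd _ fun i hi => haa i hi ▸ h'.dvd i hi)
      (h'.dvd_of_dvd _ fun i hi => haa i hi ▸ h.dvd i hi))

/-- Resultants with fixed formal degrees commute with the substitution z = t, and translation keeps
the degree, so no leading coefficient is lost. -/
theorem eval_shiftResultant (b : K[X]) (t : K) :
    (shiftResultant b).eval t = resultant b (taylor t b) := by
  have h := resultant_map_map (b.map (C : K →+* K[X])) (taylor (X : K[X]) (b.map (C : K →+* K[X])))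
    (b.map (C : K →+* K[X])).natDegree (taylor (X : K[X]) (b.map (C : K →+* K[X]))).natDegree
    (evalRingHom t)
  rw [Polynomial.map_map, map_taylor, Polynomial.map_map] at h
  have hc : (evalRingHom t).comp (C : K →+* K[X]) = RingHom.id K := by ext; simp
  rw [hc, Polynomial.map_id, natDegree_taylor, natDegree_map] at h
  rw [coe_evalRingHom, eval_X] at h
  rw [shiftResultant, natDegree_taylor, natDegree_map, natDegree_taylor]
  exact h.symm

theorem eval_shiftResultant_eq_zero_iff {b : K[X]} (hb : b ≠ 0) (t : K) :
    (shiftResultant b).eval t = 0 ↔ ¬ IsCoprime b (taylor t b) := by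
  rw [eval_shiftResultant, resultant_eq_zero_iff]
  simp [hb]

/-- Translating both arguments by t preserves the resultant and turns the pair b(x), b(x - t) into
b(x + t), b(x); exchanging them costs the sign. -/
theorem eval_neg_shiftResultant (b : K[X]) (t : K) :
    (shiftResultant b).eval (-t) =
      (-1) ^ (b.natDegree * b.natDegree) * (shiftResultant b).eval t := by
  rw [eval_shiftResultant, eval_shiftResultant, ← resultant_taylor b (taylor (-t) b) t,
    taylor_taylor, add_neg_cancel, taylor_zero, resultant_comm, natDegree_taylor]

variable [CharZero K]

theorem shiftResultant_comp_neg (b : K[X]) :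
    (shiftResultant b).comp (-X) = C ((-1) ^ (b.natDegree * b.natDegree)) * shiftResultant b := by
  refine Polynomial.funext fun t => ?_
  rw [eval_comp, eval_neg, eval_X, eval_neg_shiftResultant, eval_mul, eval_C]

/-- Otherwise every element of the infinite field K would be one of the finitely many differences of
roots of b. -/
theorem shiftResultant_ne_zero {b : K[X]} (hb : b ≠ 0) : shiftResultant b ≠ 0 := by
  classical
  intro h
  have key : ∀ t : K, ∃ α β : AlgebraicClosure K, α ∈ b.aroots (AlgebraicClosure K) ∧
      β ∈ b.aroots (AlgebraicClosure K) ∧ algebraMap K _ t = β - α := by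
    intro t
    have h1 : ¬ IsCoprime b (taylor t b) := by
      rw [← eval_shiftResultant_eq_zero_iff hb, h, eval_zero]
    rw [isCoprime_iff_aeval_ne_zero_of_isAlgClosed K (AlgebraicClosure K)] at h1
    push Not at h1
    obtain ⟨α, h2, h3⟩ := h1
    refine ⟨α, α + algebraMap K _ t, ?_, ?_, by ring⟩
    · rw [mem_aroots]; exact ⟨hb, h2⟩
    · rw [mem_aroots]; refine ⟨hb, ?_⟩
      rw [taylor_apply, aeval_comp] at h3
      simpa using h3
  choose f g hf hg hfg using key
  refine Set.infinite_univ (α := K) (Set.Finite.of_finite_image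
    (f := algebraMap K (AlgebraicClosure K))
    (Set.Finite.subset (Finset.finite_toSet
      ((((b.aroots (AlgebraicClosure K)).toFinset ×ˢ (b.aroots (AlgebraicClosure K)).toFinset).image
        fun p => p.2 - p.1))) ?_) (FaithfulSMul.algebraMap_injective _ _).injOn)
  rintro _ ⟨t, -, rfl⟩
  simp only [Finset.coe_image, Set.mem_image, Finset.mem_coe, Finset.mem_product,
    Multiset.mem_toFinset]
  exact ⟨(f t, g t), ⟨hf t, hg t⟩, (hfg t).symm⟩

/-- In characteristic zero differentiation lowers the multiplicity of a root by exactly one, so the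
gcd carries all of it but one. -/
theorem rootMultiplicity_div_gcd_derivative {R g Q : K[X]} (hR : R ≠ 0)
    (hg : IsMonicGcd R (derivative R) g) (hQ : R = Q * g) {t : K} (ht : R.IsRoot t) :
    Q.rootMultiplicity t = 1 := by
  have hpos : 0 < R.rootMultiplicity t := (rootMultiplicity_pos hR).2 ht
  have hd : derivative R ≠ 0 := by
    intro h
    obtain ⟨c, hc⟩ : ∃ c, R = C c := ⟨_, eq_C_of_derivative_eq_zero h⟩
    rw [hc, IsRoot, eval_C] at ht
    exact hR (by rw [hc, ht, C_0])
  have h1 := derivative_rootMultiplicity_of_root ht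
  have h2 : g.rootMultiplicity t ≤ (derivative R).rootMultiplicity t :=
    rootMultiplicity_le_rootMultiplicity_of_dvd hd hg.dvd_right t
  have h3 : R.rootMultiplicity t - 1 ≤ g.rootMultiplicity t := by
    rw [le_rootMultiplicity_iff hg.monic.ne_zero]
    refine hg.dvd _ ((pow_dvd_pow _ (Nat.sub_le _ _)).trans (pow_rootMultiplicity_dvd _ _)) ?_
    rw [← h1]
    exact pow_rootMultiplicity_dvd _ _
  have h4 := hQ ▸ rootMultiplicity_mul (x := t) (hQ ▸ hR)
  omega

/-- Describes S without reference to the auxiliary polynomials; its uniqueness and all later uses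
rest on this. -/
theorem ShiftSet.mem_iff {b : K[X]} {S : Finset ℕ} (h : ShiftSet b S) (l : ℕ) :
    l ∈ S ↔ 0 < l ∧ ¬ IsCoprime b (taylor (l : K) b) := by
  obtain ⟨hb, hs, ⟨hd, rfl⟩ | ⟨hd, g, R', T, hg, hR', hT, hS⟩⟩ := h
  · simp only [Finset.notMem_empty, false_iff, not_and, not_not]
    intro hl
    have hl' : (l : K) ≠ 0 := Nat.cast_ne_zero.2 hl.ne'
    rcases Nat.le_one_iff_eq_zero_or_eq_one.1 hd with hd | hd
    · rw [eq_C_of_natDegree_eq_zero hd] at hb ⊢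
      exact ⟨C (b.coeff 0)⁻¹, 0, by
        rw [zero_mul, add_zero, ← C_mul, inv_mul_cancel₀ (by simpa using hb), C_1]⟩
    · obtain ⟨a, ha, c, rfl⟩ := natDegree_eq_one.1 hd
      -- A linear polynomial and its shift differ by the nonzero constant a * l.
      refine ⟨-C (a * l)⁻¹, C (a * l)⁻¹, ?_⟩
      have h1 : (C (a * l)⁻¹ * (C a * C (l : K)) : K[X]) = 1 := by
        rw [← C_mul, ← C_mul, inv_mul_cancel₀ (mul_ne_zero ha hl'), C_1]
      simp only [map_add, taylor_mul, taylor_C, taylor_X]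
      linear_combination h1
  · rw [hS]
    refine and_congr_right fun hl => ?_
    have hl' : (l : K) ≠ 0 := Nat.cast_ne_zero.2 hl.ne'
    have h1 : T.eval ((l : K) ^ 2) = R'.eval (l : K) := by rw [← hT, eval_comp]; simp
    have hR := shiftResultant_ne_zero hb
    rw [h1, ← eval_shiftResultant_eq_zero_iff hb]
    constructor
    · intro h; rw [hR', eval_mul, h, zero_mul]
    · intro h
      -- Dividing R by the gcd keeps every root of R; the further division by z can only remove the
      -- root 0, and l ≠ 0.
      have h2 := rootMultiplicity_div_gcd_derivative hR hg (Q := R' * X) (by rw [hR']; ring) h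
      have h3 : (R' * X).IsRoot (l : K) := by
        by_contra h4
        rw [rootMultiplicity_eq_zero h4] at h2
        omega
      rw [IsRoot, eval_mul, eval_X] at h3
      exact (mul_eq_zero.1 h3).resolve_right hl'

theorem exists_comp_X_sq {R : K[X]} (h : R.comp (-X) = R) : ∃ T : K[X], T.comp (X ^ 2) = R := by
  refine ⟨contract 2 R, ?_⟩
  rw [← expand_eq_comp_X_pow]
  ext n
  rw [coeff_expand two_pos]
  split_ifs with hn
  · rw [coeff_contract two_ne_zero, Nat.div_mul_cancel hn]
  · have h1 := congrArg (fun p => coeff p n) h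
    rw [show (-X : K[X]) = C (-1) * X by simp] at h1
    simp only [comp_C_mul_X_coeff] at h1
    rw [(Nat.odd_iff.2 (by omega)).neg_one_pow] at h1
    have : (2 : K) * R.coeff n = 0 := by linear_combination -h1
    exact ((mul_eq_zero.1 this).resolve_left two_ne_zero).symm

/-- Since b is not coprime to itself, R(0) = 0, and Q = R / gcd(R, R') has a simple zero at 0; hence
z divides Q exactly once. The symmetry of R up to sign passes to the gcd up to a unit, so the
quotient R̃ satisfies R̃(-z) = const · R̃(z). Since R̃(0) ≠ 0, the constant is 1 and R̃ is a
polynomial in z². -/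
theorem ShiftSet.exists {b : K[X]} (hb : b ≠ 0) (hs : Squarefree b) : ∃ S, ShiftSet b S := by
  rcases le_or_gt b.natDegree 1 with hd | hd
  · exact ⟨∅, hb, hs, Or.inl ⟨hd, rfl⟩⟩
  have hR := shiftResultant_ne_zero hb
  obtain ⟨g, hg⟩ := IsMonicGcd.exists (b := derivative (shiftResultant b)) hR
  obtain ⟨Q, hQ⟩ := hg.dvd_left
  rw [mul_comm] at hQ
  have h0 : (shiftResultant b).IsRoot 0 := by
    rw [IsRoot, eval_shiftResultant_eq_zero_iff hb, taylor_zero, isCoprime_self]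
    intro h
    have := natDegree_eq_zero_of_isUnit h
    omega
  have hQ1 := rootMultiplicity_div_gcd_derivative hR hg hQ h0
  have hQ0 : Q ≠ 0 := by rintro rfl; simp at hQ1
  obtain ⟨R', hR'⟩ : X ∣ Q := by
    rw [X_dvd_iff, coeff_zero_eq_eval_zero]
    exact (rootMultiplicity_pos hQ0).1 (by omega)
  have hR0 : R'.eval 0 ≠ 0 := by
    intro h
    have h2 : (X - C 0) ^ 2 ∣ Q := by
      obtain ⟨r, hr⟩ := X_dvd_iff.2 ((coeff_zero_eq_eval_zero R').trans h)
      exact ⟨r, by rw [hR', hr, C_0]; ring⟩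
    rw [← le_rootMultiplicity_iff hQ0] at h2
    omega
  have hu : IsUnit (C ((-1 : K) ^ (b.natDegree * b.natDegree))) :=
    isUnit_C.2 ((isUnit_one.neg).pow _)
  have hRc := shiftResultant_comp_neg b
  have hcc : ∀ p : K[X], (p.comp (-X)).comp (-X) = p := fun p => by
    rw [comp_assoc]; simp
  have hdvd : ∀ {p q : K[X]}, p ∣ q → p.comp (-X) ∣ q.comp (-X) := by
    rintro p _ ⟨r, rfl⟩
    exact ⟨r.comp (-X), mul_comp _ _ _⟩
  have hgd : g.comp (-X) ∣ g := by
    refine hg.dvd _ ?_ ?_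
    · have := hdvd hg.dvd_left
      rwa [hRc, hu.dvd_mul_left] at this
    · have h1 := hdvd hg.dvd_right
      have h2 := congrArg derivative hRc
      rw [derivative_comp, derivative_C_mul] at h2
      simp only [derivative_neg, derivative_X] at h2
      have h3 : derivative (shiftResultant b) =
        (derivative (shiftResultant b)).comp (-X) *
          (-C ((-1 : K) ^ (b.natDegree * b.natDegree))) := by
        have h4 : (C ((-1 : K) ^ (b.natDegree * b.natDegree))) *
          C ((-1 : K) ^ (b.natDegree * b.natDegree)) = 1 := by
          rw [← C_mul, ← mul_pow]; simp
        linear_combination (-C ((-1 : K) ^ (b.natDegree * b.natDegree))) * h2 -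
          derivative (shiftResultant b) * h4
      rw [h3]
      exact h1.mul_right _
  obtain ⟨u, hgu⟩ : Associated (g.comp (-X)) g :=
    associated_of_dvd_dvd hgd (by simpa only [hcc] using hdvd hgd)
  obtain ⟨c, hc, hcu⟩ := isUnit_iff.1 u.isUnit
  have hmul : R'.comp (-X) * (X * g) =
      (-C ((-1) ^ (b.natDegree * b.natDegree)) * C c * R') * (X * g) := by
    have h1 := hRc
    rw [hQ, hR', mul_comp, mul_comp, X_comp] at h1
    rw [← hcu] at hgu
    linear_combination (-C c) * h1 - R'.comp (-X) * X * hgu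
  have hXg : (X * g : K[X]) ≠ 0 := mul_ne_zero X_ne_zero hg.monic.ne_zero
  have hev := mul_right_cancel₀ hXg hmul
  -- Evaluation at 0, where R̃ does not vanish, determines the constant.
  have hc1 : -(-1) ^ (b.natDegree * b.natDegree) * c = 1 := by
    have := congrArg (eval 0) hev
    simp only [eval_comp, eval_neg, eval_X, neg_zero, eval_mul, eval_C] at this
    exact mul_right_cancel₀ hR0 (by rw [one_mul]; exact this.symm)
  have heven : R'.comp (-X) = R' := by
    rw [hev, ← C_neg, ← C_mul, hc1, C_1, one_mul]
  obtain ⟨T, hT⟩ := exists_comp_X_sq heven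
  have hT0 : T ≠ 0 := by rintro rfl; simp [← hT] at hR0
  have hfin : {l : ℕ | 0 < l ∧ T.eval ((l : K) ^ 2) = 0}.Finite := by
    refine Set.Finite.of_finite_image (f := fun l : ℕ => (l : K) ^ 2)
      ((rootSet_finite T K).subset ?_) ?_
    · rintro _ ⟨l, hl, rfl⟩
      rw [mem_rootSet]
      exact ⟨hT0, by simpa using hl.2⟩
    · intro l _ k _ h
      have : l ^ 2 = k ^ 2 := by
        simp only at h
        exact_mod_cast h
      exact Nat.pow_left_injective two_ne_zero this
  exact ⟨hfin.toFinset, hb, hs, Or.inr ⟨hd, g, R', T, hg, by rw [hQ, hR']; ring, hT,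
    fun l => by simp⟩⟩

end ShiftSet

/-! ### Partial fractions over a field containing all poles -/

section PartialFractions

variable {L : Type*} [Field L]

/-- The rational function with principal parts prescribed by `c`. -/
noncomputable def polarSum (c : ℕ+ × L →₀ L) : RatFunc L :=
  c.sum fun i a => RatFunc.C a / (RatFunc.X - RatFunc.C i.2) ^ (i.1 : ℕ)

theorem X_sub_C_ne_zero' (α : L) : (RatFunc.X - RatFunc.C α : RatFunc L) ≠ 0 := by
  rw [← RatFunc.algebraMap_X, ← RatFunc.algebraMap_C, ← map_sub]
  exact RatFunc.algebraMap_ne_zero (X_sub_C_ne_zero α)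

theorem algebraMap_X_sub_C (α : L) :
    algebraMap L[X] (RatFunc L) (X - C α) = RatFunc.X - RatFunc.C α := by simp

@[simp] theorem polarSum_zero : polarSum (0 : ℕ+ × L →₀ L) = 0 := Finsupp.sum_zero_index

theorem polarSum_add (c d : ℕ+ × L →₀ L) : polarSum (c + d) = polarSum c + polarSum d :=
  Finsupp.sum_add_index' (by simp) (by simp [add_div])

theorem polarSum_single (i : ℕ+ × L) (a : L) :
    polarSum (Finsupp.single i a) = RatFunc.C a / (RatFunc.X - RatFunc.C i.2) ^ (i.1 : ℕ) :=
  Finsupp.sum_single_index (by simp)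

theorem polarSum_sub (c d : ℕ+ × L →₀ L) : polarSum (c - d) = polarSum c - polarSum d := by
  rw [eq_sub_iff_add_eq, ← polarSum_add, sub_add_cancel]

/-- `f` is regular at `α` and its value there is zero. -/
def VanishesAt (α : L) (f : RatFunc L) : Prop :=
  ∃ p q : L[X], q.eval α ≠ 0 ∧
    f * algebraMap L[X] (RatFunc L) q = algebraMap L[X] (RatFunc L) ((X - C α) * p)

/-- `f` has at `α` a pole of order at most `m`. -/
def PoleOrderLE (α : L) (m : ℕ) (f : RatFunc L) : Prop :=
  ∃ p q : L[X], q.eval α ≠ 0 ∧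
    f * algebraMap L[X] (RatFunc L) ((X - C α) ^ m * q) = algebraMap L[X] (RatFunc L) p

theorem VanishesAt.add {α : L} {f g : RatFunc L} (hf : VanishesAt α f) (hg : VanishesAt α g) :
    VanishesAt α (f + g) := by
  obtain ⟨p, q, hq, h⟩ := hf
  obtain ⟨p', q', hq', h'⟩ := hg
  refine ⟨p * q' + p' * q, q * q', by simp [hq, hq'], ?_⟩
  simp only [map_mul, map_add] at h h' ⊢
  linear_combination algebraMap L[X] (RatFunc L) q' * h + algebraMap L[X] (RatFunc L) q * h'

theorem VanishesAt.algebraMap_mul {α : L} {f : RatFunc L} (hf : VanishesAt α f) (r : L[X]) :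
    VanishesAt α (algebraMap L[X] (RatFunc L) r * f) := by
  obtain ⟨p, q, hq, h⟩ := hf
  refine ⟨p * r, q, hq, ?_⟩
  simp only [map_mul] at h ⊢
  linear_combination algebraMap L[X] (RatFunc L) r * h

theorem VanishesAt.neg {α : L} {f : RatFunc L} (hf : VanishesAt α f) : VanishesAt α (-f) := by
  simpa using hf.algebraMap_mul (-1)

theorem vanishesAt_algebraMap_X_sub_C_mul (α : L) (p : L[X]) :
    VanishesAt α (algebraMap L[X] (RatFunc L) ((X - C α) * p)) := ⟨p, 1, by simp, by simp⟩

theorem eval_eq_zero_of_vanishesAt {α : L} {r : L[X]}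
    (h : VanishesAt α (algebraMap L[X] (RatFunc L) r)) : r.eval α = 0 := by
  obtain ⟨p, q, hq, h⟩ := h
  rw [← map_mul] at h
  have h1 := congrArg (eval α) (RatFunc.algebraMap_injective L h)
  simp only [eval_mul, eval_sub, eval_X, eval_C, sub_self, zero_mul] at h1
  exact (mul_eq_zero.1 h1).resolve_right hq

theorem PoleOrderLE.add {α : L} {m : ℕ} {f g : RatFunc L} (hf : PoleOrderLE α m f)
    (hg : PoleOrderLE α m g) : PoleOrderLE α m (f + g) := by
  obtain ⟨p, q, hq, h⟩ := hf
  obtain ⟨p', q', hq', h'⟩ := hg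
  refine ⟨p * q' + p' * q, q * q', by simp [hq, hq'], ?_⟩
  simp only [map_mul, map_add] at h h' ⊢
  linear_combination algebraMap L[X] (RatFunc L) q' * h + algebraMap L[X] (RatFunc L) q * h'

theorem PoleOrderLE.vanishesAt {α : L} {m k : ℕ} {f : RatFunc L} (hf : PoleOrderLE α m f)
    (hk : m < k) : VanishesAt α (algebraMap L[X] (RatFunc L) ((X - C α) ^ k) * f) := by
  obtain ⟨p, q, hq, h⟩ := hf
  refine ⟨(X - C α) ^ (k - m - 1) * p, q, hq, ?_⟩
  obtain ⟨j, rfl⟩ : ∃ j, k = m + j + 1 := ⟨k - m - 1, by omega⟩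
  have e : m + j + 1 - m - 1 = j := by omega
  simp only [map_mul, map_pow, e] at h ⊢
  linear_combination algebraMap L[X] (RatFunc L) (X - C α) ^ (j + 1) * h

theorem poleOrderLE_zero (α : L) (m : ℕ) : PoleOrderLE α m 0 := ⟨0, 1, by simp, by simp⟩

theorem poleOrderLE_algebraMap (α : L) (m : ℕ) (r : L[X]) :
    PoleOrderLE α m (algebraMap L[X] (RatFunc L) r) := ⟨r * (X - C α) ^ m, 1, by simp, by simp⟩

theorem poleOrderLE_div_pow {α β : L} {m k : ℕ} (h : α = β → k ≤ m) (a : L) :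
    PoleOrderLE α m (RatFunc.C a / (RatFunc.X - RatFunc.C β) ^ k) := by
  have h0 := X_sub_C_ne_zero' β
  by_cases hβ : α = β
  · subst hβ
    refine ⟨C a * (X - C α) ^ (m - k), 1, by simp, ?_⟩
    obtain ⟨j, rfl⟩ := Nat.exists_eq_add_of_le (h rfl)
    simp only [map_mul, map_pow, algebraMap_X_sub_C, RatFunc.algebraMap_C, mul_one,
      Nat.add_sub_cancel_left, pow_add]
    field_simp
  · refine ⟨C a * (X - C α) ^ m, (X - C β) ^ k, ?_, ?_⟩
    · simpa using fun h' => (hβ (sub_eq_zero.1 h')).elim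
    · simp only [map_mul, map_pow, algebraMap_X_sub_C, RatFunc.algebraMap_C]
      field_simp

theorem poleOrderLE_polarSum {α : L} {m : ℕ} {c : ℕ+ × L →₀ L}
    (h : ∀ k : ℕ+, m < k → c (k, α) = 0) : PoleOrderLE α m (polarSum c) := by
  classical
  refine Finset.sum_induction _ (PoleOrderLE α m) (fun _ _ => PoleOrderLE.add)
    (poleOrderLE_zero α m) fun i hi => poleOrderLE_div_pow (fun hα => ?_) _
  by_contra hlt
  exact Finsupp.mem_support_iff.1 hi (by rw [← h i.1 (not_le.1 hlt), hα])

/-- The leading coefficient at a pole is the value at α of the function multiplied by (x - α)^k;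
this recovers coefficients from the function. -/
theorem vanishesAt_pow_mul_polarSum_sub {α : L} {k : ℕ+} {c : ℕ+ × L →₀ L}
    (h : ∀ j : ℕ+, k < j → c (j, α) = 0) :
    VanishesAt α (algebraMap L[X] (RatFunc L) ((X - C α) ^ (k : ℕ)) * polarSum c -
      RatFunc.C (c (k, α))) := by
  classical
  have h1 : polarSum c = RatFunc.C (c (k, α)) / (RatFunc.X - RatFunc.C α) ^ (k : ℕ) +
      polarSum (c.erase (k, α)) := by
    conv_lhs => rw [← Finsupp.single_add_erase (k, α) c, polarSum_add, polarSum_single]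
  have h2 : PoleOrderLE α (k - 1) (polarSum (c.erase (k, α))) := by
    refine poleOrderLE_polarSum fun j hj => ?_
    by_cases hjk : j = k
    · rw [hjk, Finsupp.erase_same]
    · rw [Finsupp.erase_ne (by simpa using hjk)]
      refine h j (lt_of_le_of_ne ?_ (Ne.symm hjk))
      rw [← PNat.coe_le_coe]
      omega
  have h3 := h2.vanishesAt (Nat.sub_lt k.pos one_pos)
  convert h3 using 1
  rw [h1, map_pow, algebraMap_X_sub_C]
  have := X_sub_C_ne_zero' α
  field_simp
  ring

theorem polarSum_coeff_eq_zero {α : L} {m : ℕ} {p : L[X]} {c : ℕ+ × L →₀ L}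
    (h : PoleOrderLE α m (algebraMap L[X] (RatFunc L) p + polarSum c)) {k : ℕ+} (hk : m < k) :
    c (k, α) = 0 := by
  classical
  by_contra hne
  set s := (c.support.filter fun i => i.2 = α).image Prod.fst
  have hks : k ∈ s := Finset.mem_image.2 ⟨(k, α), by simpa using hne, rfl⟩
  -- The highest order j occurring at α satisfies j ≥ k > m, so multiplication by (x - α)^j leaves
  -- the value 0 at α; that value is also the nonzero coefficient of order j.
  set j := s.max' ⟨k, hks⟩
  have hj : c (j, α) ≠ 0 := by
    obtain ⟨i, hi, hij⟩ := Finset.mem_image.1 (s.max'_mem ⟨k, hks⟩)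
    simp only [Finset.mem_filter, Finsupp.mem_support_iff] at hi
    have : i = (j, α) := Prod.ext hij hi.2
    exact this ▸ hi.1
  have hjmax : ∀ i : ℕ+, j < i → c (i, α) = 0 := by
    intro i hi
    by_contra hi0
    exact absurd (s.le_max' i (Finset.mem_image.2 ⟨(i, α), by simpa using hi0, rfl⟩)) (not_le.2 hi)
  have hkj : k ≤ j := s.le_max' k hks
  have h1 := h.vanishesAt (hk.trans_le (PNat.coe_le_coe _ _ |>.2 hkj))
  have h2 := vanishesAt_pow_mul_polarSum_sub hjmax
  have h3 := (poleOrderLE_algebraMap α 0 p).vanishesAt j.pos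
  refine hj ?_
  have h4 := (h2.neg.add h1).add h3.neg
  rw [show -(algebraMap L[X] (RatFunc L) ((X - C α) ^ (j : ℕ)) * polarSum c -
      RatFunc.C (c (j, α))) + algebraMap L[X] (RatFunc L) ((X - C α) ^ (j : ℕ)) *
      (algebraMap L[X] (RatFunc L) p + polarSum c) +
      -(algebraMap L[X] (RatFunc L) ((X - C α) ^ (j : ℕ)) * algebraMap L[X] (RatFunc L) p) =
      algebraMap L[X] (RatFunc L) (C (c (j, α))) by rw [RatFunc.algebraMap_C]; ring] at h4
  simpa using eval_eq_zero_of_vanishesAt h4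

theorem polarSum_unique {p p' : L[X]} {c c' : ℕ+ × L →₀ L}
    (h : algebraMap L[X] (RatFunc L) p + polarSum c =
      algebraMap L[X] (RatFunc L) p' + polarSum c') : c = c' := by
  have h0 : algebraMap L[X] (RatFunc L) (p - p') + polarSum (c - c') = 0 := by
    rw [map_sub, polarSum_sub]
    linear_combination h
  ext ⟨k, α⟩
  have := polarSum_coeff_eq_zero (α := α) (m := 0) (by rw [h0]; exact poleOrderLE_zero α 0) k.pos
  exact sub_eq_zero.1 this

/-- `deriv` is defined through lowest terms; this frees the quotient rule from that representation.
-/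
theorem deriv_div (p : L[X]) {q : L[X]} (hq : q ≠ 0) :
    deriv (algebraMap L[X] (RatFunc L) p / algebraMap L[X] (RatFunc L) q) =
      algebraMap L[X] (RatFunc L) (derivative p * q - p * derivative q) /
        algebraMap L[X] (RatFunc L) (q ^ 2) := by
  set f := algebraMap L[X] (RatFunc L) p / algebraMap L[X] (RatFunc L) q with hf
  have hd := f.denom_ne_zero
  have h1 : p * f.denom = f.num * q := by
    apply RatFunc.algebraMap_injective L
    rw [map_mul, map_mul, ← div_eq_div_iff (RatFunc.algebraMap_ne_zero hq)
      (RatFunc.algebraMap_ne_zero hd), RatFunc.num_div_denom]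
  have h2 := congrArg derivative h1
  rw [derivative_mul, derivative_mul] at h2
  rw [deriv, div_eq_div_iff (RatFunc.algebraMap_ne_zero (pow_ne_zero _ hd))
    (RatFunc.algebraMap_ne_zero (pow_ne_zero _ hq)), ← map_mul, ← map_mul]
  congr 1
  linear_combination (f.denom * derivative q + derivative f.denom * q) * h1 - f.denom * q * h2

theorem exists_eq_div (f : RatFunc L) : ∃ p q : L[X], q ≠ 0 ∧
    f = algebraMap L[X] (RatFunc L) p / algebraMap L[X] (RatFunc L) q :=
  ⟨f.num, f.denom, f.denom_ne_zero, f.num_div_denom.symm⟩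

theorem deriv_add (f g : RatFunc L) : deriv (f + g) = deriv f + deriv g := by
  obtain ⟨p, q, hq, rfl⟩ := exists_eq_div f
  obtain ⟨r, s, hs, rfl⟩ := exists_eq_div g
  have hq' := RatFunc.algebraMap_ne_zero hq
  have hs' := RatFunc.algebraMap_ne_zero hs
  rw [div_add_div _ _ hq' hs', ← map_mul, ← map_mul, ← map_mul, ← map_add,
    deriv_div _ (mul_ne_zero hq hs), deriv_div _ hq, deriv_div _ hs]
  simp only [derivative_mul, map_mul, map_sub, map_add, map_pow]
  field_simp
  ring

theorem deriv_zero : deriv (0 : RatFunc L) = 0 := by simp [deriv]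

theorem deriv_algebraMap (p : L[X]) :
    deriv (algebraMap L[X] (RatFunc L) p) = algebraMap L[X] (RatFunc L) (derivative p) := by
  have := deriv_div p (one_ne_zero (α := L[X]))
  simpa using this

theorem deriv_C_div_pow (a α : L) (k : ℕ+) :
    deriv (RatFunc.C a / (RatFunc.X - RatFunc.C α) ^ (k : ℕ)) =
      RatFunc.C (-(k : L) * a) / (RatFunc.X - RatFunc.C α) ^ ((k + 1 : ℕ+) : ℕ) := by
  have h0 := X_sub_C_ne_zero' α
  have h := deriv_div (C a) (pow_ne_zero (k : ℕ) (X_sub_C_ne_zero α))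
  rw [map_pow, algebraMap_X_sub_C, RatFunc.algebraMap_C] at h
  rw [h]
  obtain ⟨j, hj⟩ : ∃ j : ℕ, (k : ℕ) = j + 1 := ⟨k - 1, (Nat.succ_pred_eq_of_pos k.pos).symm⟩
  rw [PNat.add_coe, hj]
  simp only [derivative_C, zero_mul, zero_sub, derivative_X_sub_C_pow, map_neg, map_mul,
    map_pow, algebraMap_X_sub_C, RatFunc.algebraMap_C, Nat.add_sub_cancel, PNat.one_coe]
  rw [div_eq_div_iff (by positivity) (by positivity)]
  ring

theorem exists_deriv_polarSum (c : ℕ+ × L →₀ L) : ∃ c' : ℕ+ × L →₀ L,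
    deriv (polarSum c) = polarSum c' ∧ ∀ α, c' (1, α) = 0 ∧
      ∀ k : ℕ+, c' (k + 1, α) = -(k : L) * c (k, α) := by
  classical
  induction c using Finsupp.induction_linear with
  | zero => exact ⟨0, by simp [deriv_zero], by simp⟩
  | add c d hc hd =>
    obtain ⟨c', h, hc'⟩ := hc
    obtain ⟨d', h', hd'⟩ := hd
    refine ⟨c' + d', by rw [polarSum_add, polarSum_add, deriv_add, h, h'],
      fun α => ⟨?_, fun k => ?_⟩⟩
    · simp [(hc' α).1, (hd' α).1]
    · simp only [Finsupp.add_apply, (hc' α).2, (hd' α).2]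
      ring
  | single i a =>
    refine ⟨Finsupp.single (i.1 + 1, i.2) (-(i.1 : L) * a), ?_, fun α => ⟨?_, fun k => ?_⟩⟩
    · rw [polarSum_single, polarSum_single, deriv_C_div_pow]
    · rw [Finsupp.single_apply, if_neg]
      intro h
      have h' : ((i.1 + 1 : ℕ+) : ℕ) = 1 := congrArg (fun i => (i.1 : ℕ)) h
      have := i.1.pos
      rw [PNat.add_coe, PNat.one_coe] at h'
      omega
    · rw [Finsupp.single_apply, Finsupp.single_apply]
      by_cases h : i = (k, α)
      · subst h; simp
      · rw [if_neg h, if_neg, mul_zero]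
        intro h'
        simp only [Prod.mk.injEq, add_left_inj] at h'
        exact h (Prod.ext h'.1 h'.2)

theorem exists_laurent_polarSum (r : L) (c : ℕ+ × L →₀ L) : ∃ c' : ℕ+ × L →₀ L,
    RatFunc.laurent r (polarSum c) = polarSum c' ∧ ∀ k α, c' (k, α) = c (k, α + r) := by
  classical
  induction c using Finsupp.induction_linear with
  | zero => exact ⟨0, by simp, by simp⟩
  | add c d hc hd =>
    obtain ⟨c', h, hc'⟩ := hc
    obtain ⟨d', h', hd'⟩ := hd
    refine ⟨c' + d', by rw [polarSum_add, polarSum_add, map_add, h, h'], fun k α => ?_⟩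
    simp [hc', hd']
  | single i a =>
    refine ⟨Finsupp.single (i.1, i.2 - r) a, ?_, fun k α => ?_⟩
    · rw [polarSum_single, polarSum_single, map_div₀, map_pow, map_sub, RatFunc.laurent_X,
        RatFunc.laurent_C, RatFunc.laurent_C, map_sub]
      congr 2
      ring
    · rw [Finsupp.single_apply, Finsupp.single_apply]
      refine if_congr ?_ rfl rfl
      rw [Prod.ext_iff, Prod.ext_iff, sub_eq_iff_eq_add]

end PartialFractions

/-! ### The coefficients of the complete partial fraction decomposition -/

section Coeffs

variable {K : Type*} [Field K]

theorem eq_zero_of_isProper_algebraMap {p : K[X]} (h : IsProper (algebraMap K[X] (RatFunc K) p)) :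
    p = 0 := by
  rw [IsProper, RatFunc.num_algebraMap, RatFunc.denom_algebraMap, degree_one] at h
  by_contra h0
  exact absurd (zero_le_degree_iff.2 h0) (not_le.2 h)

variable (L : Type*) [Field L] [Algebra K L]

theorem baseChange_div (p q : K[X]) :
    baseChange L (algebraMap K[X] (RatFunc K) p / algebraMap K[X] (RatFunc K) q) =
      algebraMap L[X] (RatFunc L) (p.map (algebraMap K L)) /
        algebraMap L[X] (RatFunc L) (q.map (algebraMap K L)) :=
  RatFunc.map_apply_div (Polynomial.mapRingHom (algebraMap K L))
    (nonZeroDivisors_le_comap_nonZeroDivisors_of_injective _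
      (Polynomial.map_injective _ (algebraMap K L).injective)) p q

theorem baseChange_algebraMap (p : K[X]) :
    baseChange L (algebraMap K[X] (RatFunc K) p) =
      algebraMap L[X] (RatFunc L) (p.map (algebraMap K L)) := by
  simpa using baseChange_div L p 1

theorem baseChange_eq (f : RatFunc K) :
    baseChange L f = algebraMap L[X] (RatFunc L) (f.num.map (algebraMap K L)) /
      algebraMap L[X] (RatFunc L) (f.denom.map (algebraMap K L)) := by
  rw [← baseChange_div, RatFunc.num_div_denom]

theorem baseChange_deriv (f : RatFunc K) : baseChange L (deriv f) = deriv (baseChange L f) := by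
  rw [baseChange_eq L f, deriv_div _ (Polynomial.map_ne_zero f.denom_ne_zero), deriv,
    baseChange_div]
  simp

theorem baseChange_shift (r : K) (f : RatFunc K) :
    baseChange L (shift r f) = RatFunc.laurent (algebraMap K L r) (baseChange L f) := by
  obtain ⟨p, q, hq, rfl⟩ := exists_eq_div f
  rw [shift, RatFunc.laurent_div, baseChange_div, baseChange_div, RatFunc.laurent_div, map_taylor,
    map_taylor]

theorem poleOrderLE_baseChange (f : RatFunc K) (α : L) :
    PoleOrderLE α (poleOrder L f α) (baseChange L f) := by
  have hd : f.denom.map (algebraMap K L) ≠ 0 := Polynomial.map_ne_zero f.denom_ne_zero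
  obtain ⟨q, hq, hdvd⟩ := exists_eq_pow_rootMultiplicity_mul_and_not_dvd
    (f.denom.map (algebraMap K L)) hd α
  refine ⟨f.num.map (algebraMap K L), q, fun h => hdvd (dvd_iff_isRoot.2 h), ?_⟩
  rw [poleOrder, ← hq, baseChange_eq, div_mul_cancel₀ _ (RatFunc.algebraMap_ne_zero hd)]

theorem poleOrder_le_of_poleOrderLE {f : RatFunc K} {α : L} {m : ℕ}
    (h : PoleOrderLE α m (baseChange L f)) : poleOrder L f α ≤ m := by
  have hd : f.denom.map (algebraMap K L) ≠ 0 := Polynomial.map_ne_zero f.denom_ne_zero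
  obtain ⟨p, q, hq, h⟩ := h
  rw [baseChange_eq, div_mul_eq_mul_div, div_eq_iff (RatFunc.algebraMap_ne_zero hd), ← map_mul,
    ← map_mul] at h
  have h1 := RatFunc.algebraMap_injective L h
  have hcop : IsCoprime (f.num.map (algebraMap K L)) (f.denom.map (algebraMap K L)) :=
    f.isCoprime_num_denom.map (Polynomial.mapRingHom (algebraMap K L))
  have h2 : (X - C α) ^ poleOrder L f α ∣ f.denom.map (algebraMap K L) :=
    pow_rootMultiplicity_dvd _ _
  have h3 : IsCoprime ((X - C α) ^ poleOrder L f α) (f.num.map (algebraMap K L)) :=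
    (hcop.of_isCoprime_of_dvd_right h2).symm
  have h4 : IsCoprime ((X - C α) ^ poleOrder L f α) q := by
    refine IsCoprime.pow_left ((irreducible_X_sub_C α).coprime_iff_not_dvd.2 fun h => hq ?_)
    exact dvd_iff_isRoot.1 h
  have h5 : (X - C α) ^ poleOrder L f α ∣ (X - C α) ^ m :=
    h4.dvd_of_dvd_mul_right (h3.dvd_of_dvd_mul_left (h1 ▸ h2.mul_left p))
  exact (pow_dvd_pow_iff (X_sub_C_ne_zero α) (not_isUnit_X_sub_C α)).1 h5

variable [IsAlgClosed L]

theorem exists_baseChange_eq_coeffs (f : RatFunc K) : ∃ p : K[X], baseChange L f =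
    algebraMap L[X] (RatFunc L) (p.map (algebraMap K L)) + polarSum (coeffs L f) :=
  (exists_isPartialFractionDecomposition L f).choose_spec

variable {L}

/-- `coeffs` is a choice; by uniqueness any decomposition computes it, even one whose polynomial
part is only over `L`. -/
theorem coeffs_eq {f : RatFunc K} {p : L[X]} {c : ℕ+ × L →₀ L}
    (h : baseChange L f = algebraMap L[X] (RatFunc L) p + polarSum c) : coeffs L f = c := by
  obtain ⟨p', h'⟩ := exists_baseChange_eq_coeffs L f
  exact polarSum_unique (h'.symm.trans h)

theorem coeffs_zero : coeffs L (0 : RatFunc K) = 0 :=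
  coeffs_eq (p := 0) (by simp)

theorem coeffs_add (f g : RatFunc K) : coeffs L (f + g) = coeffs L f + coeffs L g := by
  obtain ⟨p, hp⟩ := exists_baseChange_eq_coeffs L f
  obtain ⟨q, hq⟩ := exists_baseChange_eq_coeffs L g
  refine coeffs_eq (p := p.map (algebraMap K L) + q.map (algebraMap K L)) ?_
  rw [map_add, hp, hq, polarSum_add, map_add]
  ring

theorem coeffs_sub (f g : RatFunc K) : coeffs L (f - g) = coeffs L f - coeffs L g := by
  rw [eq_sub_iff_add_eq, ← coeffs_add, sub_add_cancel]

theorem coeffs_C_mul (a : K) (f : RatFunc K) :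
    coeffs L (RatFunc.C a * f) = algebraMap K L a • coeffs L f := by
  obtain ⟨p, hp⟩ := exists_baseChange_eq_coeffs L f
  refine coeffs_eq (p := C (algebraMap K L a) * p.map (algebraMap K L)) ?_
  have h : polarSum (algebraMap K L a • coeffs L f) =
      RatFunc.C (algebraMap K L a) * polarSum (coeffs L f) := by
    rw [polarSum, Finsupp.sum_smul_index (by simp), polarSum, Finsupp.mul_sum]
    simp only [map_mul, mul_div_assoc]
  rw [h, map_mul, hp, ← RatFunc.algebraMap_C, baseChange_algebraMap, map_C, map_mul,
    RatFunc.algebraMap_C]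
  ring

theorem coeffs_deriv (f : RatFunc K) (α : L) : coeffs L (deriv f) (1, α) = 0 ∧
    ∀ k : ℕ+, coeffs L (deriv f) (k + 1, α) = -(k : L) * coeffs L f (k, α) := by
  obtain ⟨p, hp⟩ := exists_baseChange_eq_coeffs L f
  obtain ⟨c, hc, hc'⟩ := exists_deriv_polarSum (coeffs L f)
  rw [coeffs_eq (c := c) (p := derivative (p.map (algebraMap K L)))
    (by rw [baseChange_deriv, hp, deriv_add, deriv_algebraMap, hc])]
  exact hc' α

theorem coeffs_shift (r : K) (f : RatFunc K) (k : ℕ+) (α : L) :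
    coeffs L (shift r f) (k, α) = coeffs L f (k, α + algebraMap K L r) := by
  obtain ⟨p, hp⟩ := exists_baseChange_eq_coeffs L f
  obtain ⟨c, hc, hc'⟩ := exists_laurent_polarSum (algebraMap K L r) (coeffs L f)
  rw [coeffs_eq (c := c) (p := taylor (algebraMap K L r) (p.map (algebraMap K L)))
    (by rw [baseChange_shift, hp, map_add, RatFunc.laurent_algebraMap, hc])]
  exact hc' k α

theorem coeffs_eq_zero_of_poleOrder_lt {f : RatFunc K} {α : L} {k : ℕ+}
    (h : poleOrder L f α < k) : coeffs L f (k, α) = 0 := by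
  obtain ⟨p, hp⟩ := exists_baseChange_eq_coeffs L f
  exact polarSum_coeff_eq_zero (hp ▸ poleOrderLE_baseChange L f α) h

theorem poleOrder_le {f : RatFunc K} {α : L} {m : ℕ}
    (h : ∀ k : ℕ+, m < k → coeffs L f (k, α) = 0) : poleOrder L f α ≤ m := by
  obtain ⟨p, hp⟩ := exists_baseChange_eq_coeffs L f
  refine poleOrder_le_of_poleOrderLE L ?_
  rw [hp]
  exact (poleOrderLE_algebraMap _ _ _).add (poleOrderLE_polarSum h)

theorem coeffs_eq_zero_of_aeval_denom_ne_zero {f : RatFunc K} {α : L} (h : aeval α f.denom ≠ 0)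
    (k : ℕ+) : coeffs L f (k, α) = 0 := by
  refine coeffs_eq_zero_of_poleOrder_lt ?_
  rw [poleOrder, rootMultiplicity_eq_zero]
  · exact k.pos
  · rwa [IsRoot, eval_map_algebraMap]

/-- The residue formula a(α)/b'(α): writing b = (x - α) q gives q(α) = b'(α), and a = (x - α) q f
takes at α the value q(α) c_1(α). -/
theorem coeffs_one_mul_aeval_derivative {f : RatFunc K} (hf : ∀ (α : L) (k : ℕ+), 1 < k →
    coeffs L f (k, α) = 0) {α : L} (hα : aeval α f.denom = 0) :
    coeffs L f (1, α) * aeval α (derivative f.denom) = aeval α f.num := by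
  obtain ⟨p, hp⟩ := exists_baseChange_eq_coeffs L f
  obtain ⟨q, hq⟩ := dvd_iff_isRoot.2
    (show (f.denom.map (algebraMap K L)).IsRoot α by rwa [IsRoot, eval_map_algebraMap])
  have hd : f.denom.map (algebraMap K L) ≠ 0 := Polynomial.map_ne_zero f.denom_ne_zero
  have hq' := congrArg (eval α) (congrArg derivative hq)
  rw [derivative_map, eval_map_algebraMap, derivative_mul] at hq'
  simp only [derivative_X_sub_C, one_mul, eval_add, eval_mul, eval_sub, eval_X, eval_C, sub_self,
    zero_mul, add_zero] at hq'
  have h1 := (vanishesAt_pow_mul_polarSum_sub (hf α)).algebraMap_mul q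
  have h2 := vanishesAt_algebraMap_X_sub_C_mul α (q * p.map (algebraMap K L))
  have h3 := h1.add h2
  have h4 : algebraMap L[X] (RatFunc L) (f.num.map (algebraMap K L)) =
      algebraMap L[X] (RatFunc L) (X - C α) * algebraMap L[X] (RatFunc L) q *
      (algebraMap L[X] (RatFunc L) (p.map (algebraMap K L)) + polarSum (coeffs L f)) := by
    rw [← hp, ← map_mul, ← hq, baseChange_eq, mul_div_cancel₀ _ (RatFunc.algebraMap_ne_zero hd)]
  have h5 : algebraMap L[X] (RatFunc L) q *
      (algebraMap L[X] (RatFunc L) ((X - C α) ^ ((1 : ℕ+) : ℕ)) * polarSum (coeffs L f) -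
        RatFunc.C (coeffs L f (1, α))) +
      algebraMap L[X] (RatFunc L) ((X - C α) * (q * p.map (algebraMap K L))) =
      algebraMap L[X] (RatFunc L) (f.num.map (algebraMap K L) - C (coeffs L f (1, α)) * q) := by
    rw [map_sub, h4, PNat.one_coe, pow_one]
    simp only [map_mul, RatFunc.algebraMap_C]
    ring
  rw [h5] at h3
  have h6 := eval_eq_zero_of_vanishesAt h3
  rw [eval_sub, eval_mul, eval_C, eval_map_algebraMap, sub_eq_zero] at h6
  rw [hq', h6]

/-- Without principal parts f is a polynomial, and the only proper polynomial is zero. -/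
theorem eq_zero_of_coeffs_eq_zero {f : RatFunc K} (hf : IsProper f) (h : coeffs L f = 0) :
    f = 0 := by
  obtain ⟨p, hp⟩ := exists_baseChange_eq_coeffs L f
  rw [h, polarSum_zero, add_zero, ← baseChange_algebraMap] at hp
  rw [(baseChange L).injective hp] at hf ⊢
  rw [eq_zero_of_isProper_algebraMap hf, map_zero]

theorem coeffs_eq_zero_of_squarefree [CharZero K] {f : RatFunc K} (hf : Squarefree f.denom)
    (α : L) (k : ℕ+) (hk : 1 < k) : coeffs L f (k, α) = 0 := by
  refine coeffs_eq_zero_of_poleOrder_lt (lt_of_le_of_lt ?_ (PNat.coe_lt_coe _ _ |>.2 hk))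
  exact rootMultiplicity_le_one_of_separable
    ((PerfectField.separable_iff_squarefree.2 hf).map) α

end Coeffs

/-! ### Proper rational functions -/

section Proper

variable {K : Type*} [Field K]

theorem isProper_div {p q : K[X]} (h : p.degree < q.degree) :
    IsProper (algebraMap K[X] (RatFunc K) p / algebraMap K[X] (RatFunc K) q) := by
  have hq : q ≠ 0 := by rintro rfl; simp at h
  set f := algebraMap K[X] (RatFunc K) p / algebraMap K[X] (RatFunc K) q with hf
  have hd := f.denom_ne_zero
  have h1 : p * f.denom = f.num * q := by
    apply RatFunc.algebraMap_injective K
    rw [map_mul, map_mul, ← div_eq_div_iff (RatFunc.algebraMap_ne_zero hq)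
      (RatFunc.algebraMap_ne_zero hd), RatFunc.num_div_denom]
  have h2 : f.num.degree + q.degree < f.denom.degree + q.degree := by
    rw [← degree_mul, ← h1, degree_mul, add_comm]
    exact WithBot.add_lt_add_left (degree_ne_bot.2 hd) h
  exact lt_of_add_lt_add_right h2

theorem isProper_zero : IsProper (0 : RatFunc K) := by simp [IsProper]

theorem IsProper.add {f g : RatFunc K} (hf : IsProper f) (hg : IsProper g) : IsProper (f + g) := by
  have hf0 := f.denom_ne_zero
  have hg0 := g.denom_ne_zero
  rw [← f.num_div_denom, ← g.num_div_denom, div_add_div _ _ (RatFunc.algebraMap_ne_zero hf0)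
    (RatFunc.algebraMap_ne_zero hg0), ← map_mul, ← map_mul, ← map_mul, ← map_add]
  refine isProper_div (lt_of_le_of_lt (degree_add_le _ _) (max_lt ?_ ?_))
  · rw [degree_mul, degree_mul]
    exact WithBot.add_lt_add_right (degree_ne_bot.2 hg0) hf
  · rw [degree_mul, degree_mul]
    exact WithBot.add_lt_add_left (degree_ne_bot.2 hf0) hg

theorem IsProper.neg {f : RatFunc K} (hf : IsProper f) : IsProper (-f) := by
  rw [← f.num_div_denom, ← neg_div, ← map_neg]
  exact isProper_div (by rwa [degree_neg])

theorem IsProper.sub {f g : RatFunc K} (hf : IsProper f) (hg : IsProper g) : IsProper (f - g) :=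
  sub_eq_add_neg f g ▸ hf.add hg.neg

theorem IsProper.sum {ι : Type*} {s : Finset ι} {f : ι → RatFunc K}
    (h : ∀ i ∈ s, IsProper (f i)) : IsProper (∑ i ∈ s, f i) :=
  Finset.sum_induction _ IsProper (fun _ _ => IsProper.add) isProper_zero h

theorem IsProper.eq_of_coeffs_eq {L : Type*} [Field L] [Algebra K L] [IsAlgClosed L]
    {f g : RatFunc K} (hf : IsProper f) (hg : IsProper g) (h : coeffs L f = coeffs L g) :
    f = g :=
  sub_eq_zero.1 (eq_zero_of_coeffs_eq_zero (L := L) (hf.sub hg) (by rw [coeffs_sub, h, sub_self]))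

end Proper

/-! ### Orbits of integer translation -/

section Orbit

variable {L : Type*} [Field L]

theorem orbit_add_intCast (α : L) (l : ℤ) : orbit (α + l) = orbit α := by
  refine (QuotientAddGroup.eq.2 ?_).symm
  exact ⟨l, by simp⟩

theorem orbit_eq_iff {α β : L} : orbit α = orbit β ↔ ∃ l : ℤ, β = α + l := by
  constructor
  · intro h
    obtain ⟨l, hl⟩ := QuotientAddGroup.eq.1 h
    exact ⟨l, by
      have hl' : (l : L) = -α + β := hl
      rw [hl']; ring⟩
  · rintro ⟨l, rfl⟩
    exact (orbit_add_intCast α l).symm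

end Orbit

/-! ### Additivity and shift invariance of discrete residues -/

section Dres

variable {K : Type*} [Field K] {L : Type*} [Field L] [Algebra K L] [IsAlgClosed L]

theorem finite_support_coeffs (f : RatFunc K) (k : ℕ+) :
    (Function.support fun α : L => coeffs L f (k, α)).Finite :=
  (coeffs L f).hasFiniteSupport.preimage (f := fun α => (k, α)) (fun _ _ _ _ h => by simpa using h)

theorem dres_zero (ω : Orbit L) (k : ℕ+) : dres (0 : RatFunc K) ω k = 0 := by
  simp [dres, coeffs_zero]

theorem dres_add (f g : RatFunc K) (ω : Orbit L) (k : ℕ+) :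
    dres (f + g) ω k = dres f ω k + dres g ω k := by
  rw [dres, coeffs_add]
  exact finsum_mem_add_distrib' (s := {α : L | orbit α = ω})
    ((finite_support_coeffs f k).inter_of_right _) ((finite_support_coeffs g k).inter_of_right _)

theorem dres_sum {ι : Type*} (s : Finset ι) (f : ι → RatFunc K) (ω : Orbit L) (k : ℕ+) :
    dres (∑ i ∈ s, f i) ω k = ∑ i ∈ s, dres (f i) ω k := by
  classical
  induction s using Finset.induction_on with
  | empty => simp [dres_zero]
  | insert i s hi ih => rw [Finset.sum_insert hi, Finset.sum_insert hi, dres_add, ih]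

/-- An integer shift only permutes the coefficients within each orbit. -/
theorem dres_shift (l : ℕ) (f : RatFunc K) (ω : Orbit L) (k : ℕ+) :
    dres (shift (l : K) f) ω k = dres f ω k := by
  rw [dres, dres]
  conv_rhs => rw [← finsum_comp_equiv (Equiv.addRight (l : L))]
  refine finsum_congr fun α => ?_
  have : orbit (α + (l : L)) = orbit α := by exact_mod_cast orbit_add_intCast α (l : ℤ)
  simp only [Equiv.coe_addRight, this, coeffs_shift, map_natCast]

end Dres

/-! ### Hermite reduction -/

section Hermite

variable {K : Type*} [Field K]

theorem squarefree_denom_div {p q : K[X]} (hq : Squarefree q) :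
    Squarefree (algebraMap K[X] (RatFunc K) p / algebraMap K[X] (RatFunc K) q).denom :=
  hq.squarefree_of_dvd (RatFunc.denom_div_dvd p q)

theorem degree_mul_lt_add {p q : K[X]} {m n : ℕ} (hp : p.degree < m) (hq : q.degree ≤ n) :
    (p * q).degree < (m + n : ℕ) := by
  rw [degree_mul, Nat.cast_add]
  exact (add_le_add_right hq _).trans_lt (WithBot.add_lt_add_right (WithBot.coe_ne_bot) hp)

theorem degree_mul_lt_add' {p q : K[X]} {m n : ℕ} (hp : p.degree ≤ m) (hq : q.degree < n) :
    (p * q).degree < (m + n : ℕ) := by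
  rw [mul_comm, add_comm]
  exact degree_mul_lt_add hq hp

theorem deriv_div_add_div {p q d r e : K[X]} (hd : d ≠ 0) (hr : r ≠ 0)
    (he : r * derivative d = d * e) :
    deriv (algebraMap K[X] (RatFunc K) p / algebraMap K[X] (RatFunc K) d) +
        algebraMap K[X] (RatFunc K) q / algebraMap K[X] (RatFunc K) r =
      algebraMap K[X] (RatFunc K) (derivative p * r - p * e + q * d) /
        algebraMap K[X] (RatFunc K) (r * d) := by
  have hd' := RatFunc.algebraMap_ne_zero hd
  have hr' := RatFunc.algebraMap_ne_zero hr
  have he' := congrArg (algebraMap K[X] (RatFunc K)) he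
  rw [deriv_div _ hd]
  simp only [map_mul, map_add, map_sub, map_pow] at he' ⊢
  field_simp
  linear_combination (-algebraMap K[X] (RatFunc K) p) * he'

theorem finrank_degreeLT (n : ℕ) : Module.finrank K (degreeLT K n) = n := by
  rw [(degreeLTEquiv K n).finrank_eq, Module.finrank_fin_fun]

theorem natDegree_denom_pos {f : RatFunc K} (hf : IsProper f) (h0 : f ≠ 0) :
    0 < f.denom.natDegree := by
  rw [← Nat.cast_pos (α := WithBot ℕ), ← degree_eq_natDegree f.denom_ne_zero]
  exact (zero_le_degree_iff.2 (RatFunc.num_ne_zero h0)).trans_lt hf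

theorem HermiteLoop.proper_squarefree {f : RatFunc K} {l : List (RatFunc K)}
    (h : HermiteLoop f l) (j : ℕ) :
    IsProper (l.getD j 0) ∧ Squarefree (l.getD j 0).denom := by
  induction h generalizing j with
  | done => simpa using isProper_zero
  | step _ hr _ ih => cases j with
    | zero => exact ⟨hr.proper_right, hr.squarefree⟩
    | succ j => exact ih j

theorem getD_mapIdx_factorial (l : List (RatFunc K)) (j : ℕ) :
    (l.mapIdx fun k h => (-1) ^ k * (k.factorial : RatFunc K) * h).getD j 0 =
      RatFunc.C ((-1) ^ j * (j.factorial : K)) * l.getD j 0 := by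
  rw [List.getD_eq_getElem?_getD, List.getElem?_mapIdx, List.getD_eq_getElem?_getD]
  cases l[j]? <;> simp

theorem HermiteList.proper_squarefree {f : RatFunc K} {l : List (RatFunc K)}
    (h : HermiteList f l) (j : ℕ) :
    IsProper (l.getD j 0) ∧ Squarefree (l.getD j 0).denom := by
  obtain ⟨-, -, l', hl, rfl⟩ := h
  rw [getD_mapIdx_factorial]
  obtain ⟨h1, h2⟩ := hl.proper_squarefree j
  rw [← (l'.getD j 0).num_div_denom, ← RatFunc.algebraMap_C, ← mul_div_assoc, ← map_mul]
  exact ⟨isProper_div (by rw [← smul_eq_C_mul]; exact (degree_smul_le _ _).trans_lt h1),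
    squarefree_denom_div h2⟩

variable [CharZero K]

/-- As h has only simple poles, the coefficients of f of order k + 1 come from dg/dx alone; dividing
by -k recovers those of g. -/
theorem HermiteReduction.unique {f g h g' h' : RatFunc K} (H : HermiteReduction f g h)
    (H' : HermiteReduction f g' h') : g = g' ∧ h = h' := by
  have hg : g = g' := by
    refine H.proper_left.eq_of_coeffs_eq (L := AlgebraicClosure K) H'.proper_left ?_
    ext ⟨k, α⟩
    have h1 := congrArg (fun f => coeffs (AlgebraicClosure K) f (k + 1, α)) (H.eq.symm.trans H'.eq)
    simp only [coeffs_add, Finsupp.add_apply, (coeffs_deriv _ _).2] at h1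
    rw [coeffs_eq_zero_of_squarefree H.squarefree _ _ (PNat.lt_add_left 1 k),
      coeffs_eq_zero_of_squarefree H'.squarefree _ _ (PNat.lt_add_left 1 k), add_zero,
      add_zero] at h1
    have : CharZero (AlgebraicClosure K) := charZero_of_injective_algebraMap
      (FaithfulSMul.algebraMap_injective K _)
    exact mul_left_cancel₀ (neg_ne_zero.2 (by exact_mod_cast k.ne_zero)) h1
  subst hg
  exact ⟨rfl, add_left_cancel (H.eq.symm.trans H'.eq)⟩

-- With r the radical of the denominator and d the cofactor, look for g = p/d and h = q/r. Clearing
-- denominators makes this a linear equation in (p, q) between spaces of equal dimension deg d + deg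
-- r. Uniqueness of the reduction gives injectivity, hence surjectivity. The drop in degree makes
-- the Hermite loop terminate.
open UniqueFactorizationMonoid EuclideanDomain in
theorem HermiteReduction.exists {f : RatFunc K} (hf : IsProper f) : ∃ g h : RatFunc K,
    HermiteReduction f g h ∧ (f ≠ 0 → g.denom.natDegree < f.denom.natDegree) := by
  classical
  have hb := f.denom_ne_zero
  set r := radical f.denom with hr
  set d := divRadical f.denom with hd
  have hrd : r * d = f.denom := radical_mul_divRadical
  have hr0 : r ≠ 0 := fun h => hb (by rw [← hrd, h, zero_mul])
  have hd0 : d ≠ 0 := fun h => hb (by rw [← hrd, h, mul_zero])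
  have hdr : d.natDegree + r.natDegree = f.denom.natDegree := by
    rw [← hrd, natDegree_mul hr0 hd0, add_comm]
  -- d divides the derivative r' d + r d' of the whole denominator; thus r d is a common denominator
  -- of (p/d)' and q/r.
  obtain ⟨e, he⟩ : d ∣ r * derivative d := by
    have h := divRadical_dvd_derivative f.denom
    rw [← hd, ← hrd, derivative_mul] at h
    exact (dvd_add_right (dvd_mul_left d _)).1 h
  have hed : e.degree ≤ r.natDegree := by
    have h1 : d.degree + e.degree ≤ d.degree + r.degree := by
      rw [← degree_mul, ← he, degree_mul, add_comm]
      exact add_le_add_left (degree_derivative_le) _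
    rw [← degree_eq_natDegree hr0]
    exact WithBot.le_of_add_le_add_left (degree_ne_bot.2 hd0) h1
  have hsq : Squarefree r := squarefree_radical
  let φ₀ : K[X] × K[X] →ₗ[K] K[X] :=
    (LinearMap.mulRight K r ∘ₗ derivative - LinearMap.mulRight K e).coprod (LinearMap.mulRight K d)
  have hφ₀ : ∀ p q, φ₀ (p, q) = derivative p * r - p * e + q * d := fun p q => rfl
  let φ : degreeLT K d.natDegree × degreeLT K r.natDegree →ₗ[K]
      degreeLT K (d.natDegree + r.natDegree) :=
    LinearMap.codRestrict _ (φ₀ ∘ₗ LinearMap.prodMap (Submodule.subtype _)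
      (Submodule.subtype _)) (by
      rintro ⟨⟨p, hp⟩, q, hq⟩
      rw [mem_degreeLT] at hp hq
      change φ₀ (p, q) ∈ _
      rw [hφ₀]
      refine Submodule.add_mem _ (Submodule.sub_mem _ ?_ ?_) ?_ <;> rw [mem_degreeLT]
      · exact degree_mul_lt_add (degree_derivative_le.trans_lt hp) degree_le_natDegree
      · exact degree_mul_lt_add hp hed
      · rw [mul_comm]
        exact degree_mul_lt_add' degree_le_natDegree hq)
  have hφ : ∀ p q, (φ (p, q) : K[X]) = derivative (p : K[X]) * r - p * e + q * d := fun p q => rfl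
  have hred : ∀ (p : degreeLT K d.natDegree) (q : degreeLT K r.natDegree),
      IsProper (algebraMap K[X] (RatFunc K) (φ (p, q)) / algebraMap K[X] (RatFunc K) f.denom) →
      HermiteReduction
        (algebraMap K[X] (RatFunc K) (φ (p, q)) / algebraMap K[X] (RatFunc K) f.denom)
        (algebraMap K[X] (RatFunc K) p / algebraMap K[X] (RatFunc K) d)
        (algebraMap K[X] (RatFunc K) q / algebraMap K[X] (RatFunc K) r) := by
    intro p q h
    have hp := mem_degreeLT.1 p.2
    have hq := mem_degreeLT.1 q.2
    rw [← degree_eq_natDegree hd0] at hp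
    rw [← degree_eq_natDegree hr0] at hq
    refine ⟨h, isProper_div hp, isProper_div hq, ?_, squarefree_denom_div hsq⟩
    rw [deriv_div_add_div hd0 hr0 he, hrd, hφ]
  have hinj : Function.Injective φ := by
    rw [← LinearMap.ker_eq_bot, LinearMap.ker_eq_bot']
    rintro ⟨p, q⟩ h
    have h1 := hred p q (by rw [h]; simpa using isProper_zero)
    rw [h, Submodule.coe_zero, map_zero, _root_.zero_div] at h1
    have h2 : HermiteReduction (0 : RatFunc K) 0 0 :=
      ⟨isProper_zero, isProper_zero, isProper_zero, by rw [deriv_zero, add_zero], by simp⟩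
    obtain ⟨h3, h4⟩ := h1.unique h2
    rw [div_eq_zero_iff, or_iff_left (RatFunc.algebraMap_ne_zero hd0),
      map_eq_zero_iff _ (RatFunc.algebraMap_injective K)] at h3
    rw [div_eq_zero_iff, or_iff_left (RatFunc.algebraMap_ne_zero hr0),
      map_eq_zero_iff _ (RatFunc.algebraMap_injective K)] at h4
    exact Prod.ext (Subtype.ext h3) (Subtype.ext h4)
  have : FiniteDimensional K (degreeLT K d.natDegree) :=
    Module.Finite.equiv (degreeLTEquiv K _).symm
  have : FiniteDimensional K (degreeLT K r.natDegree) :=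
    Module.Finite.equiv (degreeLTEquiv K _).symm
  have : FiniteDimensional K (degreeLT K (d.natDegree + r.natDegree)) :=
    Module.Finite.equiv (degreeLTEquiv K _).symm
  have hsurj : Function.Surjective φ :=
    (LinearMap.injective_iff_surjective_of_finrank_eq_finrank
      (by rw [Module.finrank_prod]; simp only [finrank_degreeLT])).1 hinj
  obtain ⟨⟨p, q⟩, hpq⟩ := hsurj ⟨f.num, by
    rw [mem_degreeLT, hdr, ← degree_eq_natDegree hb]; exact hf⟩
  have h1 := hred p q
  rw [hpq, f.num_div_denom] at h1
  refine ⟨_, _, h1 hf, fun hf0 => ?_⟩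
  refine (natDegree_le_of_dvd (RatFunc.denom_div_dvd _ _) hd0).trans_lt ?_
  -- The drop is deg r, positive because the denominator of a nonzero proper function is nonconstant
  -- and divides a power of its radical.
  rw [← hdr, lt_add_iff_pos_right, Nat.pos_iff_ne_zero]
  intro hr1
  have hu : IsUnit r := by
    rw [eq_C_of_natDegree_eq_zero hr1] at hr0 ⊢
    exact isUnit_C.2 (isUnit_iff_ne_zero.2 (by simpa using hr0))
  obtain ⟨n, hn⟩ := exists_dvd_radical_self_pow hb
  exact (natDegree_denom_pos hf hf0).ne'
    (natDegree_eq_zero_of_isUnit (isUnit_of_dvd_unit hn (hu.pow n)))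

theorem HermiteLoop.unique {f : RatFunc K} {l l' : List (RatFunc K)} (h : HermiteLoop f l)
    (h' : HermiteLoop f l') : l = l' := by
  induction h generalizing l' with
  | done => cases h' with
    | done => rfl
    | step hne _ _ => exact absurd rfl hne
  | step hne hr _ ih => cases h' with
    | done => exact absurd rfl hne
    | step _ hr' hl' =>
      obtain ⟨rfl, rfl⟩ := hr.unique hr'
      rw [ih hl']

theorem HermiteLoop.exists {f : RatFunc K} (hf : IsProper f) : ∃ l, HermiteLoop f l := by
  induction hn : f.denom.natDegree using Nat.strong_induction_on generalizing f with
  | _ n ih =>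
    by_cases h0 : f = 0
    · exact ⟨[], h0 ▸ HermiteLoop.done⟩
    obtain ⟨g, h, H, hlt⟩ := HermiteReduction.exists hf
    obtain ⟨l, hl⟩ := ih _ (hn ▸ hlt h0) H.proper_left rfl
    exact ⟨h :: l, HermiteLoop.step h0 H hl⟩

/-- In f = dg/dx + h, order 1 sees only h and higher orders see only g, one order lower; the factors
-1, -2, …, -j accumulate. Position j corresponds to order j + 1. -/
theorem HermiteLoop.coeffs_eq {L : Type*} [Field L] [Algebra K L] [IsAlgClosed L]
    {f : RatFunc K} {l : List (RatFunc K)} (h : HermiteLoop f l) (j : ℕ) (α : L) :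
    coeffs L f (j.succPNat, α) = (-1) ^ j * j.factorial * coeffs L (l.getD j 0) (1, α) := by
  induction h generalizing j with
  | done => simp [coeffs_zero]
  | step _ hr _ ih =>
    rw [hr.eq, coeffs_add, Finsupp.add_apply]
    cases j with
    | zero =>
      have : Nat.succPNat 0 = 1 := rfl
      rw [this, (coeffs_deriv _ α).1]
      simp
    | succ j =>
      have : Nat.succPNat (j + 1) = j.succPNat + 1 := rfl
      rw [this, (coeffs_deriv _ α).2,
        coeffs_eq_zero_of_squarefree hr.squarefree _ _ (PNat.lt_add_left 1 _), ih,
        List.getD_cons_succ, Nat.factorial_succ, Nat.succPNat_coe]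
      push_cast
      ring

theorem HermiteList.exists {f : RatFunc K} (hf : IsProper f) (h0 : f ≠ 0) :
    ∃ l, HermiteList f l := by
  obtain ⟨l, hl⟩ := HermiteLoop.exists hf
  exact ⟨_, hf, h0, l, hl, rfl⟩

theorem HermiteList.unique {f : RatFunc K} {l l' : List (RatFunc K)} (h : HermiteList f l)
    (h' : HermiteList f l') : l = l' := by
  obtain ⟨-, -, _, hl, rfl⟩ := h
  obtain ⟨-, -, _, hl', rfl⟩ := h'
  rw [hl.unique hl']

theorem HermiteList.coeffs_eq {L : Type*} [Field L] [Algebra K L] [IsAlgClosed L]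
    {f : RatFunc K} {l : List (RatFunc K)} (h : HermiteList f l) (j : ℕ) (α : L) :
    coeffs L f (j.succPNat, α) = coeffs L (l.getD j 0) (1, α) := by
  obtain ⟨-, -, l', hl, rfl⟩ := h
  rw [getD_mapIdx_factorial, coeffs_C_mul, hl.coeffs_eq]
  simp

theorem HermiteList.dres_eq {L : Type*} [Field L] [Algebra K L] [IsAlgClosed L]
    {f : RatFunc K} {l : List (RatFunc K)} (h : HermiteList f l) (j : ℕ) (ω : Orbit L) :
    dres f ω j.succPNat = dres (l.getD j 0) ω 1 := by
  simp only [dres, h.coeffs_eq]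

/-- Beyond the end of the list the default entry is 0, so all coefficients of higher order vanish.
-/
theorem HermiteList.poleOrder_le {L : Type*} [Field L] [Algebra K L] [IsAlgClosed L]
    {f : RatFunc K} {l : List (RatFunc K)} (h : HermiteList f l) (α : L) :
    poleOrder L f α ≤ l.length := by
  refine DiscreteResidues.poleOrder_le fun k hk => ?_
  rw [← PNat.succPNat_natPred k, h.coeffs_eq, List.getD_eq_default, coeffs_zero, Finsupp.zero_apply]
  have := PNat.natPred_add_one k
  omega

end Hermite

/-! ### Common roots -/

section Roots

variable {K : Type*} [Field K]

theorem aeval_taylor {L : Type*} [Field L] [Algebra K L] (r : K) (p : K[X]) (α : L) :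
    aeval α (taylor r p) = aeval (α + algebraMap K L r) p := by
  rw [taylor_apply, aeval_comp]
  simp

theorem aeval_taylor_natCast {L : Type*} [Field L] [Algebra K L] (l : ℕ) (p : K[X]) (α : L) :
    aeval α (taylor (l : K) p) = aeval (α + l) p := by
  rw [aeval_taylor, map_natCast]

theorem aeval_taylor_neg_natCast {L : Type*} [Field L] [Algebra K L] (l : ℕ) (p : K[X]) (α : L) :
    aeval α (taylor (-(l : K)) p) = aeval (α - l) p := by
  rw [aeval_taylor, map_neg, map_natCast, sub_eq_add_neg]

theorem aeval_eq_zero_of_dvd' {L : Type*} [Field L] [Algebra K L] {p q : K[X]} (h : p ∣ q) {α : L}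
    (hα : aeval α p = 0) : aeval α q = 0 := by
  obtain ⟨r, rfl⟩ := h
  rw [map_mul, hα, zero_mul]

theorem IsMonicGcd.aeval_eq_zero_iff {L : Type*} [Field L] [Algebra K L] {a b d : K[X]}
    (h : IsMonicGcd a b d) (α : L) : aeval α d = 0 ↔ aeval α a = 0 ∧ aeval α b = 0 := by
  classical
  refine ⟨fun hα => ⟨aeval_eq_zero_of_dvd' h.dvd_left hα, aeval_eq_zero_of_dvd' h.dvd_right hα⟩,
    fun ⟨ha, hb⟩ => ?_⟩
  refine aeval_eq_zero_of_dvd'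
    (h.dvd _ (EuclideanDomain.gcd_dvd_left a b) (EuclideanDomain.gcd_dvd_right a b)) ?_
  rw [EuclideanDomain.gcd_eq_gcd_ab, map_add, map_mul, map_mul, ha, hb, zero_mul, zero_mul,
    add_zero]

theorem dvd_of_squarefree_of_aeval [CharZero K] (L : Type*) [Field L] [Algebra K L] [IsAlgClosed L]
    {p q : K[X]} (hp : Squarefree p) (h : ∀ α : L, aeval α p = 0 → aeval α q = 0) : p ∣ q := by
  by_cases hq : q = 0
  · rw [hq]; exact dvd_zero p
  have hp0 : p.map (algebraMap K L) ≠ 0 := Polynomial.map_ne_zero hp.ne_zero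
  rw [← map_dvd_map' (algebraMap K L)]
  refine (IsAlgClosed.splits _).dvd_of_roots_le_roots hp0 ((Multiset.le_iff_subset
    (nodup_roots (PerfectField.separable_iff_squarefree.2 hp).map)).2 fun α hα => ?_)
  rw [mem_roots hp0, IsRoot, eval_map_algebraMap] at hα
  rw [mem_roots (Polynomial.map_ne_zero hq), IsRoot, eval_map_algebraMap]
  exact h α hα

theorem isCoprime_of_squarefree_mul {p q : K[X]} (h : Squarefree (p * q)) : IsCoprime p q :=
  (squarefree_mul_iff.1 h).1.isCoprime

/-- The radical of b is already a common multiple of the squarefree a i, so b divides it. -/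
theorem IsMonicLcm.squarefree {ι : Type*} {s : Finset ι} {a : ι → K[X]} {b : K[X]}
    (h : IsMonicLcm s a b) (ha : ∀ i ∈ s, Squarefree (a i)) : Squarefree b := by
  classical
  refine UniqueFactorizationMonoid.squarefree_radical.squarefree_of_dvd
    (h.dvd_of_dvd (UniqueFactorizationMonoid.radical b) fun i hi => ?_)
  exact (UniqueFactorizationMonoid.dvd_radical_iff (ha i hi).isRadical h.monic.ne_zero).2
    (h.dvd i hi)

theorem IsShiftfree.of_dvd {p q : K[X]} (hq : IsShiftfree q) (h : p ∣ q) : IsShiftfree p := by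
  intro l hl
  refine ((hq l hl).of_isCoprime_of_dvd_left h).of_isCoprime_of_dvd_right ?_
  obtain ⟨r, rfl⟩ := h
  exact ⟨_, taylor_mul _ _ _⟩

theorem IsShiftfree.eq_of_orbit_eq {L : Type*} [Field L] [Algebra K L] {p : K[X]}
    (hp : IsShiftfree p) {α β : L} (hα : aeval α p = 0) (hβ : aeval β p = 0)
    (h : orbit α = orbit β) : α = β := by
  have key : ∀ (γ : L) (l : ℕ), 0 < l → aeval γ p = 0 → aeval (γ + l) p ≠ 0 := by
    intro γ l hl h₁ h₂
    rcases aeval_ne_zero_of_isCoprime (hp l hl) γ with h | h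
    · exact h h₁
    · exact h (by rw [aeval_taylor_natCast, h₂])
  obtain ⟨l, rfl⟩ := orbit_eq_iff.1 h
  rcases lt_trichotomy l 0 with hl | rfl | hl
  · obtain ⟨n, hn⟩ := Int.eq_ofNat_of_zero_le (neg_nonneg.2 hl.le)
    obtain rfl : l = -n := by omega
    refine absurd ?_ (key _ n (by omega) hβ)
    push_cast
    rwa [neg_add_cancel_right]
  · simp
  · obtain ⟨n, rfl⟩ := Int.eq_ofNat_of_zero_le hl.le
    exact absurd (by exact_mod_cast hβ) (key _ n (by omega) hα)

end Roots

/-! ### Initial roots of the integer chains of roots of a polynomial -/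

section InitialPart

variable {K : Type*} [Field K]

/-- The roots of `b₀` in `L` are the roots `α` of `b` such that no `α - ℓ`, `ℓ ≥ 1`, is a root
of `b`. -/
def IsInitialPart (L : Type*) [Field L] [Algebra K L] (b b₀ : K[X]) : Prop :=
  ∀ α : L, aeval α b₀ = 0 ↔ aeval α b = 0 ∧ ∀ l : ℕ, 0 < l → aeval (α - l) b ≠ 0

variable {L : Type*} [Field L] [Algebra K L]

theorem IsInitialPart.isShiftfree [IsAlgClosed L] {b b₀ : K[X]} (h : IsInitialPart L b b₀) :
    IsShiftfree b₀ := by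
  intro l hl
  rw [isCoprime_iff_aeval_ne_zero_of_isAlgClosed K L]
  intro α
  by_contra! hα
  rw [aeval_taylor_natCast] at hα
  exact ((h _).1 hα.2).2 l hl (by rw [add_sub_cancel_right]; exact ((h α).1 hα.1).1)

/-- Of two initial roots below α, the lower one would be a forbidden predecessor of the other. -/
theorem IsInitialPart.eq_of_sub {b b₀ : K[X]} (h : IsInitialPart L b b₀) {α : L} {l l' : ℕ}
    (hl : aeval (α - l) b₀ = 0) (hl' : aeval (α - l') b₀ = 0) : l = l' := by
  have key : ∀ i j : ℕ, i < j → aeval (α - i) b₀ = 0 → aeval (α - j) b₀ ≠ 0 := by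
    intro i j hij hi hj
    refine ((h _).1 hi).2 (j - i) (Nat.sub_pos_of_lt hij) ?_
    rw [Nat.cast_sub hij.le, sub_sub, add_sub_cancel]
    exact ((h _).1 hj).1
  rcases lt_trichotomy l l' with hlt | heq | hlt
  · exact absurd hl' (key _ _ hlt hl)
  · exact heq
  · exact absurd hl (key _ _ hlt hl')

theorem pairwise_isCoprime_of_isInitialPart [IsAlgClosed L] {b b₀ c : K[X]} {s : Finset ℕ}
    (h : IsInitialPart L b b₀) {bb : ℕ → K[X]}
    (hbb : ∀ l ∈ s, IsMonicGcd (taylor (-(l : K)) b₀) c (bb l)) :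
    (s : Set ℕ).Pairwise fun i j => IsCoprime (bb i) (bb j) := by
  intro i hi j hj hij
  rw [isCoprime_iff_aeval_ne_zero_of_isAlgClosed K L]
  intro α
  by_contra! hα
  rw [(hbb i hi).aeval_eq_zero_iff, (hbb j hj).aeval_eq_zero_iff, aeval_taylor_neg_natCast,
    aeval_taylor_neg_natCast] at hα
  exact hij (h.eq_of_sub hα.1.1 hα.2.1)

variable [CharZero K] [IsAlgClosed L]

theorem ShiftSet.mem_iff_exists_aeval {b : K[X]} {S : Finset ℕ} (hS : ShiftSet b S) (l : ℕ) :
    l ∈ S ↔ 0 < l ∧ ∃ α : L, aeval α b = 0 ∧ aeval (α - l) b = 0 := by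
  rw [hS.mem_iff, isCoprime_iff_aeval_ne_zero_of_isAlgClosed K L]
  refine and_congr_right fun _ => ?_
  push Not
  simp only [aeval_taylor_natCast]
  constructor
  · rintro ⟨α, h₁, h₂⟩
    exact ⟨α + l, h₂, by rwa [add_sub_cancel_right]⟩
  · rintro ⟨α, h₁, h₂⟩
    exact ⟨α - l, h₂, by rwa [sub_add_cancel]⟩

/-- The roots of G are the roots of b with a predecessor, S containing every distance that occurs; b
being squarefree, the cofactor b₀ has precisely the other roots. -/
theorem isInitialPart_of_isMonicLcm {b : K[X]} {S : Finset ℕ} (hS : ShiftSet b S) {g : ℕ → K[X]}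
    {G b₀ : K[X]} (hg : ∀ l ∈ S, IsMonicGcd b (taylor (-(l : K)) b) (g l)) (hG : IsMonicLcm S g G)
    (hb : b = b₀ * G) : IsInitialPart L b b₀ := by
  have hgα : ∀ l ∈ S, ∀ α : L, aeval α (g l) = 0 ↔ aeval α b = 0 ∧ aeval (α - l) b = 0 := by
    intro l hl α
    rw [(hg l hl).aeval_eq_zero_iff, aeval_taylor_neg_natCast]
  intro α
  constructor
  · intro hα
    have hbα : aeval α b = 0 := by rw [hb, map_mul, hα, zero_mul]
    refine ⟨hbα, fun l hl hlα => ?_⟩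
    have hlS : l ∈ S := (hS.mem_iff_exists_aeval (L := L) l).2 ⟨hl, α, hbα, hlα⟩
    have hGα : aeval α G = 0 := aeval_eq_zero_of_dvd' (hG.dvd l hlS) ((hgα l hlS α).2 ⟨hbα, hlα⟩)
    have hcop : IsCoprime b₀ G := isCoprime_of_squarefree_mul (hb ▸ hS.2.1)
    rcases aeval_ne_zero_of_isCoprime hcop α with h | h
    exacts [h hα, h hGα]
  · rintro ⟨hbα, h⟩
    rw [hb, map_mul, mul_eq_zero] at hbα
    refine hbα.resolve_right fun hGα => ?_
    have h1 := aeval_eq_zero_of_dvd' (hG.dvd_of_dvd (∏ l ∈ S, g l)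
      fun l hl => Finset.dvd_prod_of_mem g hl) hGα
    rw [map_prod, Finset.prod_eq_zero_iff] at h1
    obtain ⟨l, hl, hlα⟩ := h1
    exact h l ((hS.mem_iff l).1 hl).1 ((hgα l hl α).1 hlα).2

theorem prod_eq_of_isInitialPart {b b₀ c : K[X]} {S : Finset ℕ} (hS : ShiftSet b S)
    (h : IsInitialPart L b b₀) (hc : c.Monic) (hcs : Squarefree c) (hcb : c ∣ b) {bb : ℕ → K[X]}
    (hbb : ∀ l ∈ insert 0 S, IsMonicGcd (taylor (-(l : K)) b₀) c (bb l)) :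
    ∏ l ∈ insert 0 S, bb l = c := by
  refine eq_of_monic_of_associated (monic_prod_of_monic _ _ fun l hl => (hbb l hl).monic) hc
    (associated_of_dvd_dvd ?_ ?_)
  · exact Finset.prod_dvd_of_coprime (pairwise_isCoprime_of_isInitialPart h hbb)
      fun l hl => (hbb l hl).dvd_right
  · refine dvd_of_squarefree_of_aeval L hcs fun α hα => ?_
    have hbα := aeval_eq_zero_of_dvd' hcb hα
    classical
    -- Step back from α as far as possible within the roots of b. For the largest such l, α - l is
    -- initial: a root at α - l - j would put l + j into S.
    set s := (insert 0 S).filter fun l : ℕ => aeval (α - (l : L)) b = 0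
    have hne : s.Nonempty := ⟨0, by simpa [s] using hbα⟩
    set l := s.max' hne
    obtain ⟨hl, hlα⟩ := Finset.mem_filter.1 (s.max'_mem hne)
    rw [map_prod, Finset.prod_eq_zero hl]
    rw [(hbb l hl).aeval_eq_zero_iff, aeval_taylor_neg_natCast]
    refine ⟨(h _).2 ⟨hlα, fun j hj hjα => ?_⟩, hα⟩
    rw [sub_sub, ← Nat.cast_add] at hjα
    have hmem : l + j ∈ insert 0 S := Finset.mem_insert_of_mem
      ((hS.mem_iff_exists_aeval (L := L) _).2 ⟨by omega, α, hbα, hjα⟩)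
    have := s.le_max' (l + j) (Finset.mem_filter.2 ⟨hmem, hjα⟩)
    omega

end InitialPart

/-! ### Partial fractions with prescribed denominators -/

section ParFrac

variable {K : Type*} [Field K]

theorem denom_sum_dvd {ι : Type*} {s : Finset ι} {f : ι → RatFunc K} {q : K[X]} (hq : q ≠ 0)
    (h : ∀ i ∈ s, (f i).denom ∣ q) : (∑ i ∈ s, f i).denom ∣ q := by
  refine Finset.sum_induction f (fun x => x.denom ∣ q) (fun x y hx hy => ?_) (by simp) h
  rw [RatFunc.denom_dvd hq] at hx hy ⊢
  obtain ⟨p, rfl⟩ := hx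
  obtain ⟨r, rfl⟩ := hy
  exact ⟨p + r, by rw [map_add, add_div]⟩

/-- Properness removes the polynomial part. A zero numerator would let the nonconstant factor b l
drop out of the denominator of f. -/
theorem ParFrac.exists {f : RatFunc K} (hf : IsProper f) (hs : Squarefree f.denom) {N : Finset ℕ}
    {b : ℕ → K[X]} (hb : ∀ l ∈ N, (b l).Monic) (hdeg : ∀ l ∈ N, 1 ≤ (b l).natDegree)
    (hcop : (N : Set ℕ).Pairwise fun i j => IsCoprime (b i) (b j))
    (hprod : ∏ l ∈ N, b l = f.denom) : ∃ a, ParFrac f N b a := by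
  classical
  obtain ⟨q, a, ha, h⟩ := div_prod_eq_quo_add_sum_rem_div (RatFunc K) f.num hb hcop
  have h' : f = algebraMap K[X] (RatFunc K) q + ∑ l ∈ N,
      algebraMap K[X] (RatFunc K) (a l) / algebraMap K[X] (RatFunc K) (b l) := by
    refine Eq.trans ?_ h
    conv_lhs => rw [← f.num_div_denom, ← hprod, map_prod]
  have hq : q = 0 := by
    refine eq_zero_of_isProper_algebraMap ?_
    rw [eq_sub_of_add_eq h'.symm]
    exact hf.sub (IsProper.sum fun l hl => isProper_div (ha l hl))
  rw [hq, map_zero, zero_add] at h'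
  refine ⟨a, hf, hs, hb, hdeg, hprod, fun l hl hal => ?_, ha, h'⟩
  have hM : (∏ i ∈ N.erase l, b i).Monic :=
    monic_prod_of_monic _ _ fun i hi => hb i (Finset.mem_of_mem_erase hi)
  have h1 : f.denom ∣ ∏ i ∈ N.erase l, b i := by
    rw [h', ← Finset.add_sum_erase _ _ hl, hal, map_zero, zero_div, zero_add]
    exact denom_sum_dvd hM.ne_zero fun i hi =>
      (RatFunc.denom_div_dvd _ _).trans (Finset.dvd_prod_of_mem b hi)
  have h2 := natDegree_le_of_dvd h1 hM.ne_zero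
  rw [← hprod, ← Finset.mul_prod_erase _ _ hl, (hb l hl).natDegree_mul hM] at h2
  have := hdeg l hl
  omega

theorem ParFrac.pairwise_isCoprime {f : RatFunc K} {N : Finset ℕ} {b a : ℕ → K[X]}
    (h : ParFrac f N b a) : (N : Set ℕ).Pairwise fun i j => IsCoprime (b i) (b j) := by
  classical
  intro i hi j hj hij
  refine isCoprime_of_squarefree_mul (h.squarefree.squarefree_of_dvd ?_)
  rw [← h.prod_eq, ← Finset.prod_pair hij]
  exact Finset.prod_dvd_prod_of_subset _ _ _ (by
    intro k hk
    rcases Finset.mem_insert.1 hk with rfl | hk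
    · exact hi
    · exact Finset.mem_singleton.1 hk ▸ hj)

theorem ParFrac.unique {f : RatFunc K} {N : Finset ℕ} {b a a' : ℕ → K[X]}
    (h : ParFrac f N b a) (h' : ParFrac f N b a') : ∀ l ∈ N, a l = a' l :=
  (quo_add_sum_rem_div_unique (RatFunc K) (q₁ := 0) (q₂ := 0) h.monic h.pairwise_isCoprime
    h.degree_lt h'.degree_lt (congrArg _ (h.eq_sum.symm.trans h'.eq_sum))).2

theorem ParFrac.congr_denoms {f : RatFunc K} {N : Finset ℕ} {b b' a : ℕ → K[X]}
    (h : ParFrac f N b a) (hb : ∀ l ∈ N, b l = b' l) : ParFrac f N b' a where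
  proper := h.proper
  squarefree := h.squarefree
  monic l hl := hb l hl ▸ h.monic l hl
  nonconstant l hl := hb l hl ▸ h.nonconstant l hl
  prod_eq := (Finset.prod_congr rfl hb).symm.trans h.prod_eq
  ne_zero := h.ne_zero
  degree_lt l hl := hb l hl ▸ h.degree_lt l hl
  eq_sum := h.eq_sum.trans (Finset.sum_congr rfl fun l hl => by rw [hb l hl])

end ParFrac

/-! ### Simple reduction -/

section SimpleReduction

variable {K : Type*} [Field K]

theorem shift_div (r : K) (p q : K[X]) :
    shift r (algebraMap K[X] (RatFunc K) p / algebraMap K[X] (RatFunc K) q) =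
      algebraMap K[X] (RatFunc K) (taylor r p) / algebraMap K[X] (RatFunc K) (taylor r q) :=
  RatFunc.laurent_div r p q

theorem filter_natDegree_prod_eq {s : Finset ℕ} {b : ℕ → K[X]} (hb : ∀ l ∈ s, (b l).Monic) :
    ∏ l ∈ s with 1 ≤ (b l).natDegree, b l = ∏ l ∈ s, b l := by
  refine Finset.prod_filter_of_ne fun l hl h => ?_
  by_contra hlt
  exact h ((hb l hl).natDegree_eq_zero.1 (by omega))

variable {ι : Type*}

theorem ReduceBranch.unique {f f' f'' : ι → RatFunc K} {b : K[X]} {S : Finset ℕ}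
    (h : ReduceBranch f b S f') (h' : ReduceBranch f b S f'') : f' = f'' := by
  obtain ⟨g, G, b₀, hg, hG, hb, h⟩ := h
  obtain ⟨g', G', b₀', hg', hG', hb', h'⟩ := h'
  obtain rfl : G = G' := hG.unique hG' fun l hl => (hg l hl).unique (hg' l hl)
  obtain rfl : b₀ = b₀' := mul_right_cancel₀ hG.monic.ne_zero (hb.symm.trans hb')
  funext i
  obtain ⟨bb, a, N, hbb, hN, hpf, hf'⟩ := h i
  obtain ⟨bb', a', N', hbb', hN', hpf', hf''⟩ := h' i
  have hbe : ∀ l ∈ insert 0 S, bb l = bb' l := fun l hl => (hbb l hl).unique (hbb' l hl)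
  obtain rfl : N = N' := by
    rw [hN, hN']
    exact Finset.filter_congr fun l hl => by rw [hbe l hl]
  have hNS : ∀ l ∈ N, bb l = bb' l := fun l hl =>
    hbe l (Finset.mem_of_mem_filter l (hN ▸ hl))
  have hae := hpf.unique (hpf'.congr_denoms fun l hl => (hNS l hl).symm)
  rw [hf', hf'']
  exact Finset.sum_congr rfl fun l hl => by rw [hNS l hl, hae l hl]

/-- Each bb l divides σ^{-l} b₀, so σ^l carries it to a divisor of b₀. -/
theorem ReduceBranch.proper_denom_dvd {f f' : ι → RatFunc K} {b : K[X]} {S : Finset ℕ}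
    (hb : b ≠ 0) {b₀ : K[X]} {i : ι} {bb a : ℕ → K[X]} {N : Finset ℕ} (hb₀ : b₀ ∣ b)
    (hbb : ∀ l ∈ insert 0 S, IsMonicGcd (taylor (-(l : K)) b₀) (f i).denom (bb l))
    (hN : N = {l ∈ insert 0 S | 1 ≤ (bb l).natDegree}) (hpf : ParFrac (f i) N bb a)
    (hf' : f' i = ∑ l ∈ N, shift (l : K)
        (algebraMap K[X] (RatFunc K) (a l) / algebraMap K[X] (RatFunc K) (bb l))) :
    IsProper (f' i) ∧ (f' i).denom ∣ b₀ := by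
  rw [hf']
  refine ⟨IsProper.sum fun l hl => ?_, denom_sum_dvd (ne_zero_of_dvd_ne_zero hb hb₀) fun l hl => ?_⟩
  · rw [shift_div]
    exact isProper_div (by rw [degree_taylor, degree_taylor]; exact hpf.degree_lt l hl)
  · rw [shift_div]
    refine (RatFunc.denom_div_dvd _ _).trans ?_
    obtain ⟨r, hr⟩ := (hbb l (Finset.mem_of_mem_filter l (hN ▸ hl))).dvd_left
    refine ⟨taylor (l : K) r, ?_⟩
    rw [← taylor_mul, ← hr, taylor_taylor, add_neg_cancel, taylor_zero]

theorem SimpleReductionPlus.dres_eq [Fintype ι] {L : Type*} [Field L] [Algebra K L] [IsAlgClosed L]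
    {f f' : ι → RatFunc K} (h : SimpleReductionPlus f f') (i : ι) (ω : Orbit L) (k : ℕ+) :
    dres (f' i) ω k = dres (f i) ω k := by
  obtain ⟨-, b, S, -, -, ⟨-, rfl⟩ | ⟨-, g, G, b₀, -, -, -, h⟩⟩ := h
  · rfl
  · obtain ⟨bb, a, N, -, -, hpf, hf'⟩ := h i
    rw [hf', hpf.eq_sum, dres_sum, dres_sum]
    simp only [dres_shift]

variable [CharZero K]

theorem ReduceBranch.exists {f : ι → RatFunc K} {b : K[X]} {S : Finset ℕ}
    (hf : ∀ i, IsProper (f i) ∧ Squarefree (f i).denom) (hfb : ∀ i, (f i).denom ∣ b)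
    (hS : ShiftSet b S) : ∃ f', ReduceBranch f b S f' := by
  have hb := hS.1
  have hg : ∀ l : ℕ, ∃ g, IsMonicGcd b (taylor (-(l : K)) b) g := fun l => IsMonicGcd.exists hb
  choose g hg using hg
  obtain ⟨G, hG⟩ := IsMonicLcm.exists S (a := g) fun l _ => (hg l).monic.ne_zero
  obtain ⟨b₀, hb₀⟩ := hG.dvd_of_dvd b fun l _ => (hg l).dvd_left
  rw [mul_comm] at hb₀
  have hin : IsInitialPart (AlgebraicClosure K) b b₀ :=
    isInitialPart_of_isMonicLcm hS (fun l _ => hg l) hG hb₀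
  have hb₀0 : b₀ ≠ 0 := fun h => hb (by rw [hb₀, h, zero_mul])
  have key : ∀ i, ∃ (bb a : ℕ → K[X]) (N : Finset ℕ),
      (∀ l ∈ insert 0 S, IsMonicGcd (taylor (-(l : K)) b₀) (f i).denom (bb l)) ∧
      N = {l ∈ insert 0 S | 1 ≤ (bb l).natDegree} ∧ ParFrac (f i) N bb a := by
    intro i
    have hbb : ∀ l : ℕ, ∃ c, IsMonicGcd (taylor (-(l : K)) b₀) (f i).denom c := fun l =>
      IsMonicGcd.exists (by rwa [Ne, taylor_eq_zero])
    choose bb hbb using hbb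
    obtain ⟨a, ha⟩ := ParFrac.exists (hf i).1 (hf i).2
      (N := {l ∈ insert 0 S | 1 ≤ (bb l).natDegree}) (fun l _ => (hbb l).monic)
      (fun l hl => (Finset.mem_filter.1 hl).2)
      (pairwise_isCoprime_of_isInitialPart hin fun l _ => hbb l)
      (by rw [filter_natDegree_prod_eq fun l _ => (hbb l).monic,
            prod_eq_of_isInitialPart hS hin (f i).monic_denom (hf i).2 (hfb i) fun l _ => hbb l])
    exact ⟨bb, a, _, fun l _ => hbb l, rfl, ha⟩
  choose bb a N hbb hN ha using key
  exact ⟨_, g, G, b₀, fun l _ => hg l, hG, hb₀, fun i => ⟨bb i, a i, N i, hbb i, hN i, ha i, rfl⟩⟩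

variable [Fintype ι]

theorem SimpleReductionPlus.exists {f : ι → RatFunc K}
    (hf : ∀ i, IsProper (f i) ∧ Squarefree (f i).denom) : ∃ f', SimpleReductionPlus f f' := by
  obtain ⟨b, hb⟩ := IsMonicLcm.exists Finset.univ (a := fun i => (f i).denom)
    fun i _ => (f i).denom_ne_zero
  obtain ⟨S, hS⟩ := ShiftSet.exists hb.monic.ne_zero (hb.squarefree fun i _ => (hf i).2)
  by_cases hS0 : S = ∅
  · exact ⟨f, hf, b, S, hb, hS, Or.inl ⟨hS0, rfl⟩⟩
  · obtain ⟨f', hf'⟩ := ReduceBranch.exists hf (fun i => hb.dvd i (Finset.mem_univ i)) hS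
    exact ⟨f', hf, b, S, hb, hS, Or.inr ⟨hS0, hf'⟩⟩

theorem SimpleReductionPlus.unique {f f' f'' : ι → RatFunc K} (h : SimpleReductionPlus f f')
    (h' : SimpleReductionPlus f f'') : f' = f'' := by
  obtain ⟨-, b, S, hb, hS, h⟩ := h
  obtain ⟨-, b', S', hb', hS', h'⟩ := h'
  obtain rfl := hb.unique hb' fun _ _ => rfl
  obtain rfl : S = S' := by
    ext l
    rw [hS.mem_iff, hS'.mem_iff]
  rcases h with ⟨hS0, rfl⟩ | ⟨hS0, h⟩ <;> rcases h' with ⟨hS0', rfl⟩ | ⟨hS0', h'⟩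
  · rfl
  · exact absurd hS0 hS0'
  · exact absurd hS0' hS0
  · exact h.unique h'

/-- If S is empty, b itself is shiftfree; otherwise b₀ serves. -/
theorem SimpleReductionPlus.exists_common_denom {f f' : ι → RatFunc K}
    (h : SimpleReductionPlus f f') : ∃ b₀ : K[X], Squarefree b₀ ∧ IsShiftfree b₀ ∧
      ∀ i, IsProper (f' i) ∧ (f' i).denom ∣ b₀ := by
  obtain ⟨hf, b, S, hb, hS, ⟨hS0, rfl⟩ | ⟨-, g, G, b₀, hg, hG, hb₀, h⟩⟩ := h
  · refine ⟨b, hS.2.1, fun l hl => ?_, fun i => ⟨(hf i).1, hb.dvd i (Finset.mem_univ i)⟩⟩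
    by_contra hcop
    have := (hS.mem_iff l).2 ⟨hl, hcop⟩
    simp [hS0] at this
  · have hin : IsInitialPart (AlgebraicClosure K) b b₀ := isInitialPart_of_isMonicLcm hS hg hG hb₀
    have hdvd : b₀ ∣ b := ⟨G, hb₀⟩
    refine ⟨b₀, hS.2.1.squarefree_of_dvd hdvd, hin.isShiftfree, fun i => ?_⟩
    obtain ⟨bb, a, N, hbb, hN, hpf, hf'⟩ := h i
    exact ReduceBranch.proper_denom_dvd hS.1 hdvd hbb hN hpf hf'

end SimpleReduction

/-! ### First residues -/

section FirstResidues

variable {K : Type*} [Field K]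

theorem FirstResidues.eq_denom {f : RatFunc K} {b r : K[X]} (h : FirstResidues f b r) :
    b = f.denom := by
  rcases h with ⟨rfl, rfl, -⟩ | ⟨-, -, -, h, -⟩
  · rw [RatFunc.denom_zero]
  · exact h

/-- Separability is a Bézout relation for b and b', so b' is invertible modulo b. -/
theorem exists_mul_derivative_congr {b : K[X]} (hb : b.Monic) (hs : b.Separable) (a : K[X]) :
    ∃ r : K[X], r.degree < b.degree ∧ b ∣ r * derivative b - a := by
  obtain ⟨u, v, huv⟩ := hs
  refine ⟨(a * v) %ₘ b, degree_modByMonic_lt _ hb, ?_⟩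
  have h := modByMonic_add_div (a * v) b
  refine ⟨-(a * u) - (a * v /ₘ b) * derivative b, ?_⟩
  linear_combination derivative b * h + a * huv

variable {ι : Type*} [Fintype ι]

theorem FirstResiduesPlus.isMonicLcm {f : ι → RatFunc K} {b : K[X]} {p : ι → K[X]}
    (h : FirstResiduesPlus f b p) : IsMonicLcm Finset.univ (fun i => (f i).denom) b := by
  obtain ⟨-, b', r, hr, hb, -⟩ := h
  rwa [show b' = fun i => (f i).denom from funext fun i => (hr i).eq_denom] at hb

theorem FirstResiduesPlus.exists_complement {f : ι → RatFunc K} {b : K[X]} {p : ι → K[X]}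
    (h : FirstResiduesPlus f b p) (i : ι) : ∃ d : K[X], b = d * (f i).denom ∧
      (p i).degree < b.degree ∧
      (f i).denom ∣ p i * derivative (f i).denom - (f i).num ∧ d ∣ p i := by
  obtain ⟨-, b', r, hr, -, h⟩ := h
  rw [← (hr i).eq_denom]
  exact h i

theorem FirstResiduesPlus.squarefree {f : ι → RatFunc K} {b : K[X]} {p : ι → K[X]}
    (h : FirstResiduesPlus f b p) : Squarefree b :=
  h.isMonicLcm.squarefree fun i _ => (h.1 i).2

theorem FirstResiduesPlus.coeffs_eq_zero {L : Type*} [Field L] [Algebra K L] [IsAlgClosed L]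
    {f : ι → RatFunc K} {b : K[X]} {p : ι → K[X]} (h : FirstResiduesPlus f b p) (i : ι) {α : L}
    (hα : aeval α b ≠ 0) (k : ℕ+) : coeffs L (f i) (k, α) = 0 :=
  coeffs_eq_zero_of_aeval_denom_ne_zero
    (fun h' => hα (aeval_eq_zero_of_dvd' (h.isMonicLcm.dvd i (Finset.mem_univ i)) h')) k

theorem FirstResiduesPlus.dres_eq_zero {L : Type*} [Field L] [Algebra K L] [IsAlgClosed L]
    {f : ι → RatFunc K} {b : K[X]} {p : ι → K[X]} (h : FirstResiduesPlus f b p) (i : ι)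
    {ω : Orbit L} (hω : ∀ α : L, orbit α = ω → aeval α b ≠ 0) (k : ℕ+) : dres (f i) ω k = 0 := by
  rw [dres]
  exact finsum_mem_eq_zero_of_forall_eq_zero (s := {α | orbit α = ω})
    fun α hα => h.coeffs_eq_zero i (hω α hα) k

variable [CharZero K]

theorem FirstResidues.exists {f : RatFunc K} (hf : IsProper f) (hs : Squarefree f.denom) :
    ∃ b r, FirstResidues f b r := by
  by_cases h0 : f = 0
  · exact ⟨1, 0, Or.inl ⟨h0, rfl, rfl⟩⟩
  obtain ⟨r, hr, hdvd⟩ := exists_mul_derivative_congr f.monic_denom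
    (PerfectField.separable_iff_squarefree.2 hs) f.num
  refine ⟨f.denom, r, Or.inr ⟨h0, hf, hs, rfl, ?_, hr, hdvd⟩⟩
  rintro rfl
  rw [zero_mul, zero_sub, dvd_neg] at hdvd
  exact absurd (degree_le_of_dvd hdvd (RatFunc.num_ne_zero h0)) (not_le.2 hf)

theorem FirstResiduesPlus.exists {f : ι → RatFunc K}
    (hf : ∀ i, IsProper (f i) ∧ Squarefree (f i).denom) : ∃ b p, FirstResiduesPlus f b p := by
  choose b' r hr using fun i => FirstResidues.exists (hf i).1 (hf i).2
  have hb' : ∀ i, b' i = (f i).denom := fun i => (hr i).eq_denom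
  obtain ⟨b, hb⟩ := IsMonicLcm.exists Finset.univ (a := b')
    fun i _ => hb' i ▸ (f i).denom_ne_zero
  have hsq : Squarefree b := hb.squarefree fun i _ => hb' i ▸ (hf i).2
  have key : ∀ i, ∃ p d : K[X], b = d * b' i ∧ p.degree < b.degree ∧
      b' i ∣ p * derivative (b' i) - (f i).num ∧ d ∣ p := by
    intro i
    rw [hb' i]
    obtain ⟨d, hd⟩ := hb.dvd i (Finset.mem_univ i)
    rw [hb' i, mul_comm] at hd
    obtain ⟨u, v, huv⟩ := isCoprime_of_squarefree_mul (hd ▸ hsq)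
    obtain ⟨s, -, hs⟩ := exists_mul_derivative_congr (f i).monic_denom
      (PerfectField.separable_iff_squarefree.2 (hf i).2) (f i).num
    have hmod := modByMonic_add_div (s * (u * d)) b
    -- Chinese remainders: u * d is 1 modulo the denominator of f i and 0 modulo its complement d.
    refine ⟨(s * (u * d)) %ₘ b, d, hd, degree_modByMonic_lt _ hb.monic, ?_, ?_⟩
    · obtain ⟨w, hw⟩ := hs
      refine ⟨w - s * v * derivative (f i).denom -
        d * (s * (u * d) /ₘ b) * derivative (f i).denom, ?_⟩
      generalize (s * (u * d)) %ₘ b = x at hmod ⊢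
      generalize s * (u * d) /ₘ b = y at hmod ⊢
      rw [hd] at hmod
      linear_combination hw + derivative (f i).denom * hmod + s * derivative (f i).denom * huv
    · rw [eq_sub_of_add_eq hmod]
      refine dvd_sub (Dvd.intro_left (s * u) (by ring)) (Dvd.dvd.mul_right ?_ _)
      exact ⟨_, hd⟩
  choose p hp using key
  exact ⟨b, p, hf, b', r, hr, hb, hp⟩

/-- Two solutions agree modulo the denominator, whose derivative is invertible there, and modulo the
coprime complement; so they agree modulo b, and degrees decide. -/
theorem FirstResiduesPlus.unique {f : ι → RatFunc K} {b b' : K[X]} {p p' : ι → K[X]}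
    (h : FirstResiduesPlus f b p) (h' : FirstResiduesPlus f b' p') : b = b' ∧ p = p' := by
  obtain rfl := h.isMonicLcm.unique h'.isMonicLcm fun _ _ => rfl
  refine ⟨rfl, funext fun i => ?_⟩
  obtain ⟨d, hd, hdeg, hdvd, hdp⟩ := h.exists_complement i
  obtain ⟨d', hd', hdeg', hdvd', hdp'⟩ := h'.exists_complement i
  obtain rfl : d = d' := mul_right_cancel₀ (f i).denom_ne_zero (hd.symm.trans hd')
  have hcop : IsCoprime d (f i).denom := isCoprime_of_squarefree_mul (hd ▸ h.squarefree)
  have hsep : (f i).denom.Separable := PerfectField.separable_iff_squarefree.2 (h.1 i).2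
  have h1 : (f i).denom ∣ p i - p' i := by
    have := dvd_sub hdvd hdvd'
    rw [sub_sub_sub_cancel_right, ← sub_mul] at this
    exact IsCoprime.dvd_of_dvd_mul_right hsep this
  have h2 : b ∣ p i - p' i := hd ▸ hcop.mul_dvd (dvd_sub hdp hdp') h1
  exact sub_eq_zero.1 (eq_zero_of_dvd_of_degree_lt h2
    ((degree_sub_le _ _).trans_lt (max_lt hdeg hdeg')))

/-- At a root of b that is no pole of f i, the complement d vanishes, and both sides are zero. -/
theorem FirstResiduesPlus.aeval_eq {L : Type*} [Field L] [Algebra K L] [IsAlgClosed L]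
    {f : ι → RatFunc K} {b : K[X]} {p : ι → K[X]} (h : FirstResiduesPlus f b p) (i : ι) {α : L}
    (hα : aeval α b = 0) : coeffs L (f i) (1, α) = aeval α (p i) := by
  obtain ⟨d, hd, -, hdvd, hdp⟩ := h.exists_complement i
  have hsep : (f i).denom.Separable := PerfectField.separable_iff_squarefree.2 (h.1 i).2
  by_cases hα' : aeval α (f i).denom = 0
  · have h1 := coeffs_one_mul_aeval_derivative (coeffs_eq_zero_of_squarefree (h.1 i).2) hα'
    have h2 := aeval_eq_zero_of_dvd' hdvd hα'
    rw [map_sub, map_mul, sub_eq_zero] at h2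
    refine mul_right_cancel₀ ?_ (h1.trans h2.symm)
    exact hsep.aeval_derivative_ne_zero hα'
  · rw [coeffs_eq_zero_of_aeval_denom_ne_zero hα']
    rw [hd, map_mul, mul_eq_zero, or_iff_left hα'] at hα
    exact (aeval_eq_zero_of_dvd' hdp hα).symm

/-- Shiftfreeness leaves α as the only possible pole in its orbit, so the orbit sum has one term. -/
theorem FirstResiduesPlus.dres_eq {L : Type*} [Field L] [Algebra K L] [IsAlgClosed L]
    {f : ι → RatFunc K} {b : K[X]} {p : ι → K[X]} (h : FirstResiduesPlus f b p)
    (hb : IsShiftfree b) (i : ι) {α : L} (hα : aeval α b = 0) :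
    dres (f i) (orbit α) 1 = aeval α (p i) := by
  rw [← h.aeval_eq i hα, dres, finsum_eq_single _ α]
  · simp
  · intro β hβ
    by_cases hβα : orbit β = orbit α
    · have hβ0 : aeval β b ≠ 0 := fun hβ0 => hβ (hb.eq_of_orbit_eq hβ0 hα hβα)
      simp [h.coeffs_eq_zero i hβ0]
    · simp [hβα]

end FirstResidues

/-! ### Discrete residues -/

section DiscreteResidues

variable {K : Type*} [Field K] {n : ℕ}

theorem DiscreteResiduesPlus.squarefree {f : Fin n → RatFunc K} {out : Output K n}
    (h : DiscreteResiduesPlus f out) : Squarefree out.B := by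
  obtain ⟨-, l, g, -, -, -, hp⟩ := h
  exact hp.squarefree

variable [CharZero K]

theorem DiscreteResiduesPlus.exists {f : Fin n → RatFunc K}
    (hf : ∀ i, IsProper (f i) ∧ f i ≠ 0) : ∃ out, DiscreteResiduesPlus f out := by
  choose l hl using fun i => HermiteList.exists (hf i).1 (hf i).2
  set m := Finset.univ.sup fun i => (l i).length with hm
  obtain ⟨f', hf'⟩ := SimpleReductionPlus.exists
    (f := fun ik : Fin n × Fin m => (l ik.1).getD ik.2 0)
    fun ik => (hl ik.1).proper_squarefree ik.2
  obtain ⟨b₀, hsq, -, hb₀⟩ := hf'.exists_common_denom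
  obtain ⟨B, p, hp⟩ := FirstResiduesPlus.exists
    fun ik => ⟨(hb₀ ik).1, hsq.squarefree_of_dvd (hb₀ ik).2⟩
  exact ⟨⟨m, B, fun i k => p (i, k)⟩, hf, l, f', hl, hm, hf', hp⟩

theorem DiscreteResiduesPlus.unique {f : Fin n → RatFunc K} {out out' : Output K n}
    (h : DiscreteResiduesPlus f out) (h' : DiscreteResiduesPlus f out') : out = out' := by
  obtain ⟨m, B, D⟩ := out
  obtain ⟨m', B', D'⟩ := out'
  obtain ⟨-, l, g, hl, hm, hg, hp⟩ := h
  obtain ⟨-, l', g', hl', hm', hg', hp'⟩ := h'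
  obtain rfl : l = l' := funext fun i => (hl i).unique (hl' i)
  dsimp only at *
  obtain rfl : m = m' := hm.trans hm'.symm
  obtain rfl := hg.unique hg'
  obtain ⟨rfl, hD⟩ := hp.unique hp'
  obtain rfl : D = D' := funext fun i => funext fun k => congrFun hD (i, k)
  rfl

/-- B is the lcm of reduced denominators that all divide one shiftfree polynomial; shiftfreeness of
each separately would not suffice. -/
theorem DiscreteResiduesPlus.isShiftfree {f : Fin n → RatFunc K} {out : Output K n}
    (h : DiscreteResiduesPlus f out) : IsShiftfree out.B := by
  obtain ⟨-, l, g, -, -, hg, hp⟩ := h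
  obtain ⟨b₀, -, hsf, hb₀⟩ := hg.exists_common_denom
  exact hsf.of_dvd (hp.isMonicLcm.dvd_of_dvd _ fun ik _ => (hb₀ ik).2)

theorem DiscreteResiduesPlus.isRationalSystem (L : Type*) [Field L] [Algebra K L] [IsAlgClosed L]
    {f : Fin n → RatFunc K} {out : Output K n} (h : DiscreteResiduesPlus f out) (i : Fin n) :
    IsRationalSystem L (f i) fun k => (out.B, out.D i k) := by
  have hsf := h.isShiftfree
  have hsq := h.squarefree
  obtain ⟨-, l, g, hl, hm, hg, hp⟩ := h
  have hdres : ∀ (k : Fin out.m) (ω : Orbit L),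
      dres (f i) ω (Nat.succPNat k) = dres (g (i, k)) ω 1 := fun k ω => by
    rw [(hl i).dres_eq, hg.dres_eq]
  refine ⟨fun α => ((hl i).poleOrder_le α).trans ?_, fun _ => hsq.ne_zero, fun _ => hsq,
    fun _ => hsf, fun k => ?_, fun k ω hω => ?_, fun k α hα => ?_⟩
  · rw [hm]
    exact Finset.le_sup (f := fun i => (l i).length) (Finset.mem_univ i)
  · obtain ⟨_, _, hdeg, _⟩ := hp.exists_complement (i, k)
    exact hdeg
  · rw [hdres]
    exact hp.dres_eq_zero (i, k) hω 1
  · rw [hdres]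
    exact hp.dres_eq hsf (i, k) hα

end DiscreteResidues

end DiscreteResidues

theorem corollary7p3 {K : Type*} [Field K] [CharZero K]
    (L : Type*) [Field L] [Algebra K L] [IsAlgClosed L] [Algebra.IsAlgebraic K L]
    {n : ℕ} (f : Fin n → RatFunc K) (hf : ∀ i, DiscreteResidues.IsProper (f i) ∧ f i ≠ 0) :
    (∃! out : DiscreteResidues.Output K n, DiscreteResidues.DiscreteResiduesPlus f out) ∧
      ∀ out : DiscreteResidues.Output K n, DiscreteResidues.DiscreteResiduesPlus f out →
        Squarefree out.B ∧ DiscreteResidues.IsShiftfree out.B ∧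
        (∀ i, DiscreteResidues.IsRationalSystem L (f i) (fun k => (out.B, out.D i k))) ∧
        (∀ α β : L, Polynomial.aeval α out.B = 0 → Polynomial.aeval β out.B = 0 →
          DiscreteResidues.orbit α = DiscreteResidues.orbit β → α = β) := by
  refine ⟨?_, fun out h => ⟨h.squarefree, h.isShiftfree, h.isRationalSystem L,
    fun α β hα hβ hαβ => h.isShiftfree.eq_of_orbit_eq hα hβ hαβ⟩⟩
  obtain ⟨out, h⟩ := DiscreteResidues.DiscreteResiduesPlus.exists hf
  exact ⟨out, h, fun out' h' => h'.unique h⟩
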